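/- Finite words over $\{0,1\}$ form a free monoid; morphisms are monoid endomorphisms of $\{0,1\}^*$, extended letterwise to infinite words. A morphism $\psi$ is primitive if for some $k\ge 1$ each letter occurs in $\psi^k(0)$ and in $\psi^k(1)$. An infinite word is Sturmian if it has exactly $n+1$ factors of each length $n\ge 0$; a morphism is Sturmian if it maps every Sturmian word to a Sturmian word. Let $$\varphi_a: 0\mapsto 0,\ 1\mapsto 10,\quad \varphi_b: 0\mapsto 0,\ 1\mapsto 01,\quad \varphi_\alpha: 0\mapsto 01,\ 1\mapsto 1,\quad \varphi_\beta: 0\mapsto 10,\ 1\mapsto 1,$$ and $\varphi_w=\varphi_{w_0}\circ\cdots\circ\varphi_{w_{n-1}}$ for $w=w_0\cdots w_{n-1}\in\{a,b,\alpha,\beta\}^*$. The normalized name of $\varphi_w$ is the lexicographically greatest word (for $a<b$, $\alpha<\beta$) obtainable from $w$ by the rewriting rules $\alpha a^k\beta=\beta b^k\alpha$ and $a\alpha^k b=b\beta^k a$, $k\ge 0$, applied in either direction. For a nonempty prefix $p$ of an infinite word $\mathbf u$, a return word to $p$ is a word $u_i\cdots u_{j-1}$ with $i<j$ consecutive occurrences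 of $p$ in $\mathbf u$. If the return words to $p$ are finitely many, say $r_0,\dots,r_{k-1}$ (distinct), and $\mathbf u=r_{s_0}r_{s_1}r_{s_2}\cdots$, then $s_0s_1s_2\cdots$ is the derivated word of $\mathbf u$ with respect to $p$. Let $\mathrm{Der}(\mathbf u)$ be the set of derivated words of $\mathbf u$ with respect to its nonempty prefixes, where words that differ only by a permutation of letters are identified. **Corollary 5.5.** Let $w\in\{a,b,\alpha,\beta\}^*\setminus\{a,\alpha\}^*$ be the normalized name of the morphism $\varphi_w$, assume that $\varphi_w$ is primitive, and let $\mathbf u$ be a fixed point of $\varphi_w$. Then $\mathrm{Der}(\mathbf u)$ is finite and $$1\le \#\mathrm{Der}(\mathbf u)\le 3|w|-4 .$$ Moreover, for every $n\ge 2$ there is a normalized name $w'\in\{a,b,\alpha,\beta\}^*\setminus\{a,\alpha\}^*$ of length $n$, and for every $n\ge 3$ there is a normalized name $w''\in\{a,b,\alpha,\beta\}^*\setminus\{a,\alpha\}^*$ of length $n$, such that $\varphi_{w'}$ and $\varphi_{w''}$ are primitive, have fixed points, and are not powers of other Sturmian morphisms, and every fixed point $\mathbf u'$ of $\varphi_{w'}$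 and every fixed point $\mathbf u''$ of $\varphi_{w''}$ satisfy $\#\mathrm{Der}(\mathbf u')=1$ and $\#\mathrm{Der}(\mathbf u'')=3n-4$. -/

import Mathlib

namespace SturmDer

/-! ### Finite and infinite words -/

/-- Finite words over the alphabet `{0,1}`. -/
abbrev Word := FreeMonoid (Fin 2)

/-- Infinite words over the alphabet `{0,1}`. -/
abbrev InfWord := ℕ → Fin 2

/-- The factor `u_i u_{i+1} ⋯ u_{i+n-1}` of the infinite word `u`. -/
def factor (u : InfWord) (i n : ℕ) : Word :=
  FreeMonoid.ofList (List.ofFn fun t : Fin n => u (i + t))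

/-- The prefix of `u` of length `n`. -/
def pref (u : InfWord) (n : ℕ) : Word := factor u 0 n

/-- The factor complexity of `u`: the number of distinct factors of length `n`. -/
noncomputable def complexity (u : InfWord) (n : ℕ) : ℕ :=
  (Set.range fun i => factor u i n).ncard

/-- `u` is a Sturmian word: it has exactly `n + 1` factors of each length `n`. -/
def IsSturmianWord (u : InfWord) : Prop := ∀ n, complexity u n = n + 1

/-! ### Morphisms -/

/-- Morphisms over `{0,1}*`; multiplication is composition. -/
abbrev Morph := Monoid.End Word

/-- The infinite word `v` is the image `ψ(u_0) ψ(u_1) ψ(u_2) ⋯` of the infinite word `u`. -/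
def IsImage (ψ : Morph) (u v : InfWord) : Prop :=
  (∀ n, ψ (pref u n) = pref v (ψ (pref u n)).length) ∧
  ∀ m, ∃ n, m ≤ (ψ (pref u n)).length

/-- `u` is a fixed point of `ψ`, that is, `ψ(u) = u`. -/
def IsFixedPoint (ψ : Morph) (u : InfWord) : Prop := IsImage ψ u u

/-- `ψ` is primitive: for some `k ≥ 1` each letter occurs in the image under `ψ^k` of each letter. -/
def IsPrimitive (ψ : Morph) : Prop :=
  ∃ k : ℕ, 0 < k ∧ ∀ x y : Fin 2, x ∈ (ψ ^ k) (FreeMonoid.of y)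

/-- `ψ` is a Sturmian morphism: it maps every Sturmian word to a Sturmian word. -/
def IsSturmianMorphism (ψ : Morph) : Prop :=
  ∀ u, IsSturmianWord u → ∃ v, IsImage ψ u v ∧ IsSturmianWord v

/-- `ψ` is not a power of any other Sturmian morphism. -/
def NotPowerOfOther (ψ : Morph) : Prop :=
  ∀ (η : Morph) (k : ℕ), IsSturmianMorphism η → ψ = η ^ k → η = ψ

/-- The morphism with `0 ↦ x` and `1 ↦ y`. -/
def morph (x y : Word) : Morph := FreeMonoid.lift ![x, y]

/-- The names `a`, `b`, `α`, `β` of the four elementary Sturmian morphisms. -/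
inductive Gen where
  | a
  | b
  | α
  | β

/-- The four elementary morphisms
`φ_a : 0 ↦ 0, 1 ↦ 10`, `φ_b : 0 ↦ 0, 1 ↦ 01`, `φ_α : 0 ↦ 01, 1 ↦ 1`, `φ_β : 0 ↦ 10, 1 ↦ 1`. -/
def elem : Gen → Morph
  | .a => morph (FreeMonoid.ofList [0]) (FreeMonoid.ofList [1, 0])
  | .b => morph (FreeMonoid.ofList [0]) (FreeMonoid.ofList [0, 1])
  | .α => morph (FreeMonoid.ofList [0, 1]) (FreeMonoid.ofList [1])
  | .β => morph (FreeMonoid.ofList [1, 0]) (FreeMonoid.ofList [1])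

/-- `φ_w = φ_{w_0} ∘ φ_{w_1} ∘ ⋯ ∘ φ_{w_{n-1}}`. -/
def phi (w : List Gen) : Morph := (w.map elem).prod

/-! ### Normalized names -/

/-- One application, from left to right, of one of the rewriting rules
`α a^k β = β b^k α` and `a α^k b = b β^k a` (`k ≥ 0`) inside a word. -/
inductive Step : List Gen → List Gen → Prop
  | greek (x y : List Gen) (k : ℕ) :
      Step (x ++ (.α :: List.replicate k .a ++ [.β]) ++ y)
        (x ++ (.β :: List.replicate k .b ++ [.α]) ++ y)
  | latin (x y : List Gen) (k : ℕ) :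
      Step (x ++ (.a :: List.replicate k .α ++ [.b]) ++ y)
        (x ++ (.b :: List.replicate k .β ++ [.a]) ++ y)

/-- `v` can be obtained from `w` by the rewriting rules, applied in either direction. -/
def Rewrites (w v : List Gen) : Prop := Relation.EqvGen Step w v

/-- The order on letters: `a < b` and `α < β`. -/
inductive GenLt : Gen → Gen → Prop
  | latin : GenLt .a .b
  | greek : GenLt .α .β

/-- `n = N(w)`: `n` is the lexicographically greatest word that can be obtained from `w` by the
rewriting rules. -/
def IsNormalForm (w n : List Gen) : Prop :=
  Rewrites w n ∧ ∀ v, Rewrites w v → v = n ∨ List.Lex GenLt v n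

/-- `n` is the normalized name of `ψ`: `n = N(w)` for a word `w` with `ψ = φ_w`. -/
def IsNormalizedName (ψ : Morph) (n : List Gen) : Prop :=
  ∃ w, ψ = phi w ∧ IsNormalForm w n

/-- `w` belongs to `{a, α}*`. -/
def InAAlpha (w : List Gen) : Prop := ∀ x ∈ w, x = .a ∨ x = .α

/-! ### Derivated words -/

/-- `i` is an occurrence of `p` in `u`. -/
def IsOcc (u : InfWord) (p : Word) (i : ℕ) : Prop := factor u i p.length = p

/-- The return words to `p` in `u`: the words `u_i ⋯ u_{j-1}` for consecutive occurrences `i < j`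
of `p`. -/
def returnWords (u : InfWord) (p : Word) : Set Word :=
  {x | ∃ i j, i < j ∧ IsOcc u p i ∧ IsOcc u p j ∧ (∀ t, i < t → t < j → ¬ IsOcc u p t) ∧
    x = factor u i (j - i)}

/-- `u` is the infinite concatenation `x_0 x_1 x_2 ⋯`. -/
def IsConcat (x : ℕ → Word) (u : InfWord) : Prop :=
  (∀ n, ((List.range n).map x).prod = pref u (((List.range n).map x).prod).length) ∧
  ∀ m, ∃ n, m ≤ (((List.range n).map x).prod).length

/-- `d` is a derivated word of `u` with respect to `p`, over the alphabet `{0, …, k-1}`: the return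
words to `p` are the distinct words `r_0, …, r_{k-1}`, and `u = r_{d_0} r_{d_1} r_{d_2} ⋯`.
(The numbering of the return words is arbitrary.) -/
def IsDerivated (u : InfWord) (p : Word) (d : ℕ → ℕ) : Prop :=
  ∃ (k : ℕ) (r : Fin k → Word) (s : ℕ → Fin k),
    Function.Injective r ∧ Set.range r = returnWords u p ∧
    IsConcat (fun i => r (s i)) u ∧ ∀ i, d i = s i

/-- Two infinite words over `ℕ` are identified if they differ by a permutation of letters. -/
def permSetoid : Setoid (ℕ → ℕ) where
  r d e := ∃ σ : Equiv.Perm ℕ, ∀ i, e i = σ (d i)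
  iseqv :=
    { refl := fun _ => ⟨Equiv.refl ℕ, fun _ => rfl⟩
      symm := fun ⟨σ, h⟩ => ⟨σ.symm, fun i => by rw [h i, Equiv.symm_apply_apply]⟩
      trans := fun ⟨σ, h⟩ ⟨τ, g⟩ => ⟨σ.trans τ, fun i => by rw [g i, h i, Equiv.trans_apply]⟩ }

/-- `Der(u)`: the set of derivated words of `u` with respect to its nonempty prefixes, derivated
words being identified if they differ only by a permutation of letters. -/
def Der (u : InfWord) : Set (Quotient permSetoid) :=
  {q | ∃ m d, 0 < m ∧ IsDerivated u (pref u m) d ∧ q = Quotient.mk permSetoid d}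

end SturmDer

open SturmDer

/-!
Call `b`, `β` ones and `a`, `α` zeros. If `u = φ_c(v)`, the occurrences of a prefix of `u` are the
positions in `u` of the blocks `φ_c(v_i)` at the occurrences `i` of a prefix of `v`, and since
`φ_c` is injective the two prefixes have the same derivated words (`isDerivated_iff`). For a one
`c` every prefix of `v`, the empty one included, is met in this way, and the empty prefix has the
derivated word `v` itself; so `Der u = {v} ∪ Der v` (`Der_elem_one`). For a zero the empty prefix
is not met, provided that `v` starts with the letter moved by `φ_c`, and `Der u = Der v`
(`Der_elem_zero`). Hence, if `u = φ_{x_0}(u_1)`, `u_1 = φ_{x_1}(u_2)`, … for an infinite directive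
word `x_0 x_1 x_2 ⋯` in which no factor `α a^k β` or `a α^k b` occurs (`Admissible`), the set
`Der u` consists of the words `u_{i+1}` with `x_i` a one. If the directive word is eventually
periodic, this set is finite (`Der_eq_states`).

A normalized name `w` is admissible. The fixed point `u` of `φ_w` has the directive word
`w w w ⋯`, which may fail to be admissible where two copies of `w` meet. There `w = h b m a t`
with `h ∈ {α, b}*` and `t ∈ {a, α}*`, and the relation `a x b = b x' a` (`phi_carry`), where `x'` is
`x ∈ {a, b, α}*` with every `α` replaced by `β`, rewrites `w w w ⋯` as `d₀ d₁ d₁ d₁ ⋯` with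
`|d₀| = |d₁| = |w|` (`derBound_of_carry`). This is admissible if `w` starts and ends with letters
of different alphabets `{a, b}`, `{α, β}`, and then `Der u` has at most `2 |w| - 2` elements: `d₁`
contains a zero, and either `d₀` does too or `d₀` and `d₁` both end with `β`, in which case the
word fixed by `φ_{d₁}` is counted twice. In the remaining case rotating the first run of letters
of one alphabet, at most `|w| - 2` letters, to the end of `w` reaches the case above, and each
rotated letter costs at most one derivated word (`exists_rotation`, `derBound_of_run`). The total
is `3 |w| - 4`.

The minimum is attained by `a^m β`, whose only derivated word is the fixed point. The maximum is
attained by `b^m α a`, with directive word `b^m α b^{m+1} (β b^m a)(β b^m a) ⋯`. The `3 m + 2` words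
seen along it differ, up to a permutation of letters, already in the positions of the first two
letters `1` (`shape_seed`), except when a word is compared with the complement of another one,
which takes longer prefixes in a few cases (`not_compl_fixed`). That these morphisms are not powers
follows by counting letters `1` in the images of the letters under `η, η², …` (`root_cases`).
-/

namespace SturmDer

open FreeMonoid

/-! ### Factors of infinite words -/

@[simp] theorem length_factor (u : InfWord) (i n : ℕ) : (factor u i n).length = n := by
  simp [factor, FreeMonoid.length]

@[simp] theorem length_pref (u : InfWord) (n : ℕ) : (pref u n).length = n := length_factor u 0 n

@[simp] theorem factor_zero (u : InfWord) (i : ℕ) : factor u i 0 = 1 := by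
  simp [factor]

@[simp] theorem pref_zero (u : InfWord) : pref u 0 = 1 := factor_zero u 0

theorem factor_one (u : InfWord) (i : ℕ) : factor u i 1 = of (u i) := by
  simp [factor]

theorem factor_eq_iff (u v : InfWord) (i j n : ℕ) :
    factor u i n = factor v j n ↔ ∀ t < n, u (i + t) = v (j + t) := by
  unfold factor
  rw [Equiv.apply_eq_iff_eq, List.ofFn_inj]
  constructor
  · intro h t ht
    exact congrFun h ⟨t, ht⟩
  · intro h
    funext t
    exact h t t.2

theorem factor_add (u : InfWord) (i m n : ℕ) :
    factor u i (m + n) = factor u i m * factor u (i + m) n := by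
  unfold factor
  rw [← ofList_append, Equiv.apply_eq_iff_eq]
  rw [List.ofFn_add]
  simp [Nat.add_assoc]

theorem pref_add (u : InfWord) (m n : ℕ) : pref u (m + n) = pref u m * factor u m n := by
  have := factor_add u 0 m n
  rwa [Nat.zero_add] at this

theorem pref_succ (u : InfWord) (n : ℕ) : pref u (n + 1) = pref u n * of (u n) := by
  rw [pref_add, factor_one]

theorem pref_eq_iff (u v : InfWord) (n : ℕ) : pref u n = pref v n ↔ ∀ t < n, u t = v t := by
  simpa [pref] using factor_eq_iff u v 0 0 n

/-- Cancellation of factors of equal length on the left. -/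
theorem mul_eq_mul_of_length {x x' y y' : Word} (h : x * y = x' * y')
    (hl : x.length = x'.length) : x = x' ∧ y = y' :=
  List.append_inj h hl

theorem isOcc_pref_iff (u : InfWord) (n j : ℕ) :
    IsOcc u (pref u n) j ↔ ∀ t < n, u (j + t) = u t := by
  unfold IsOcc
  rw [length_pref]
  simpa [pref] using factor_eq_iff u u j 0 n

/-- Two prefixes of an infinite word are comparable. -/
theorem pref_eq_mul_of_le (u : InfWord) {m n : ℕ} (h : m ≤ n) :
    pref u n = pref u m * factor u m (n - m) := by
  conv_lhs => rw [← Nat.add_sub_cancel' h]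
  exact pref_add u m (n - m)

/-! ### Images of infinite words -/

/-- A morphism that erases no letter. -/
def NonErasing (ψ : Morph) : Prop := ∀ c, ψ (of c) ≠ 1

/-- The position in `ψ(u)` at which the image of the `n`-th letter of `u` begins. -/
def cut (ψ : Morph) (u : InfWord) (n : ℕ) : ℕ := (ψ (pref u n)).length

@[simp] theorem cut_zero (ψ : Morph) (u : InfWord) : cut ψ u 0 = 0 := by
  simp [cut]

theorem cut_add (ψ : Morph) (u : InfWord) (m n : ℕ) :
    cut ψ u (m + n) = cut ψ u m + (ψ (factor u m n)).length := by
  simp [cut, pref_add]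

theorem cut_succ (ψ : Morph) (u : InfWord) (n : ℕ) :
    cut ψ u (n + 1) = cut ψ u n + (ψ (of (u n))).length := by
  rw [cut_add, factor_one]

theorem NonErasing.length_pos {ψ : Morph} (h : NonErasing ψ) (c : Fin 2) :
    0 < (ψ (of c)).length :=
  Nat.pos_of_ne_zero fun h0 => h c (length_eq_zero.1 h0)

theorem NonErasing.strictMono_cut {ψ : Morph} (h : NonErasing ψ) (u : InfWord) :
    StrictMono (cut ψ u) :=
  strictMono_nat_of_lt_succ fun n => by
    rw [cut_succ]; exact Nat.lt_add_of_pos_right (h.length_pos _)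

theorem NonErasing.length_le {ψ : Morph} (h : NonErasing ψ) (x : Word) :
    x.length ≤ (ψ x).length := by
  induction x using FreeMonoid.inductionOn' with
  | one => simp
  | of_mul c x ih =>
    have := h.length_pos c
    simp only [map_mul, length_mul, length_of]
    omega

theorem NonErasing.one : NonErasing (1 : Morph) := fun c => by
  simp [of_ne_one]

theorem NonErasing.mul {ψ η : Morph} (hψ : NonErasing ψ) (hη : NonErasing η) :
    NonErasing (ψ * η) := fun c h => by
  have h1 := hψ.length_le (η (of c))
  have h2 := hη.length_pos c
  have h3 : ψ (η (of c)) = 1 := h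
  rw [h3] at h1
  simp at h1
  rw [h1] at h2
  simp at h2

theorem IsImage.map_factor {ψ : Morph} {v u : InfWord} (h : IsImage ψ v u) (i n : ℕ) :
    ψ (factor v i n) = factor u (cut ψ v i) (ψ (factor v i n)).length := by
  have h1 := h.1 (i + n)
  have h2 := h.1 i
  rw [show (ψ (pref v (i + n))).length = cut ψ v (i + n) from rfl, cut_add, pref_add, pref_add,
    map_mul] at h1
  refine (mul_eq_mul_of_length h1 ?_).2
  rw [length_pref]
  rfl

theorem IsImage.map_of {ψ : Morph} {v u : InfWord} (h : IsImage ψ v u) (i : ℕ) :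
    ψ (of (v i)) = factor u (cut ψ v i) (ψ (of (v i))).length := by
  have := h.map_factor i 1
  rwa [factor_one] at this

theorem IsImage.map_pref {ψ : Morph} {v u : InfWord} (h : IsImage ψ v u) (n : ℕ) :
    ψ (pref v n) = pref u (cut ψ v n) := h.1 n

theorem IsImage.unique {ψ : Morph} {u v v' : InfWord} (h : IsImage ψ u v) (h' : IsImage ψ u v') :
    v = v' := by
  funext m
  obtain ⟨n, hn⟩ := h.2 (m + 1)
  exact (pref_eq_iff v v' _).1 ((h.map_pref n).symm.trans (h'.map_pref n)) m hn

theorem IsImage.comp {ψ η : Morph} {u v z : InfWord} (h : IsImage η u v) (h' : IsImage ψ v z) :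
    IsImage (ψ * η) u z := by
  have key : ∀ n, (ψ * η) (pref u n) = pref z (cut ψ v (cut η u n)) := fun n => by
    change ψ (η (pref u n)) = _
    rw [h.map_pref, h'.map_pref]
  refine ⟨fun n => ?_, fun m => ?_⟩
  · rw [key, length_pref]
  · obtain ⟨n, hn⟩ := h'.2 m
    obtain ⟨k, hk⟩ := h.2 n
    refine ⟨k, ?_⟩
    rw [key, length_pref]
    refine hn.trans ?_
    change cut ψ v n ≤ cut ψ v (cut η u k)
    rw [← Nat.add_sub_cancel' (show n ≤ cut η u k from hk), cut_add]
    exact Nat.le_add_right _ _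

/-- The infinite word `ψ(u)`; it is meaningful if `ψ` erases no letter. -/
def image (ψ : Morph) (u : InfWord) : InfWord := fun n => (ψ (pref u (n + 1))).toList.getD n 0

theorem isImage_image {ψ : Morph} (h : NonErasing ψ) (u : InfWord) :
    IsImage ψ u (image ψ u) := by
  have hmono := h.strictMono_cut u
  refine ⟨fun n => ?_, fun m => ⟨m, hmono.le_apply⟩⟩
  apply (FreeMonoid.toList).injective
  apply List.ext_getElem
  · exact (length_pref _ _).symm
  · intro t ht ht'
    have hlt : t < (ψ (pref u (t + 1))).toList.length :=
      lt_of_lt_of_le (Nat.lt_succ_self t) (hmono.le_apply (x := t + 1))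
    have e : (pref (image ψ u) (ψ (pref u n)).length).toList[t] =
        (ψ (pref u (t + 1))).toList[t] := by
      have e1 : (pref (image ψ u) (ψ (pref u n)).length).toList[t] = image ψ u t := by
        simp [pref, factor]
        rfl
      rw [e1, image, List.getD_eq_getElem?_getD, List.getElem?_eq_getElem hlt, Option.getD_some]
    rw [e]
    rcases le_total n (t + 1) with hn | hn
    · have e2 := congrArg (fun x => (ψ x).toList) (pref_eq_mul_of_le u hn)
      simp only [map_mul, toList_mul] at e2
      simp only [e2]
      rw [List.getElem_append_left]
    · have e2 := congrArg (fun x => (ψ x).toList) (pref_eq_mul_of_le u hn)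
      simp only [map_mul, toList_mul] at e2
      simp only [e2]
      rw [List.getElem_append_left]

theorem image_eq {ψ : Morph} (h : NonErasing ψ) {u v : InfWord} (hv : IsImage ψ u v) :
    image ψ u = v := (isImage_image h u).unique hv

theorem image_mul {ψ η : Morph} (hψ : NonErasing ψ) (hη : NonErasing η) (u : InfWord) :
    image (ψ * η) u = image ψ (image η u) :=
  image_eq (hψ.mul hη) ((isImage_image hη u).comp (isImage_image hψ _))

theorem image_one (u : InfWord) : image 1 u = u := by
  apply image_eq NonErasing.one
  exact ⟨fun n => by simp, fun m => ⟨m, by simp⟩⟩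

/-! ### Derivated words under injective morphisms -/

/-- The end of the `n`-th block of a concatenation. -/
def concatLen (x : ℕ → Word) (n : ℕ) : ℕ := (((List.range n).map x).prod).length

theorem concatLen_zero (x : ℕ → Word) : concatLen x 0 = 0 := by simp [concatLen]

theorem prod_range_succ (x : ℕ → Word) (n : ℕ) :
    ((List.range (n + 1)).map x).prod = ((List.range n).map x).prod * x n := by
  simp [List.range_succ]

theorem concatLen_succ (x : ℕ → Word) (n : ℕ) :
    concatLen x (n + 1) = concatLen x n + (x n).length := by
  rw [concatLen, prod_range_succ, length_mul]
  rfl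

theorem IsConcat.prod_eq {x : ℕ → Word} {u : InfWord} (h : IsConcat x u) (n : ℕ) :
    ((List.range n).map x).prod = pref u (concatLen x n) := h.1 n

theorem IsConcat.eq_factor {x : ℕ → Word} {u : InfWord} (h : IsConcat x u) (n : ℕ) :
    x n = factor u (concatLen x n) (x n).length := by
  have h1 := h.prod_eq (n + 1)
  rw [concatLen_succ, pref_add, prod_range_succ] at h1
  exact (mul_eq_mul_of_length h1 (length_pref _ _).symm).2

/-- In a decomposition of `u` into return words to a prefix, every block starts at an occurrence
of that prefix: a return word followed by the prefix starts with the prefix. -/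
theorem IsConcat.isOcc {u : InfWord} {m : ℕ} {x : ℕ → Word} (h : IsConcat x u)
    (hx : ∀ n, x n ∈ returnWords u (pref u m)) (n : ℕ) :
    IsOcc u (pref u m) (concatLen x n) := by
  rw [isOcc_pref_iff]
  intro t
  induction t using Nat.strong_induction_on generalizing n with
  | _ t ih =>
    intro ht
    obtain ⟨i, j, hij, hi, hj, -, hxn⟩ := hx n
    rw [isOcc_pref_iff] at hi hj
    have hlen : (x n).length = j - i := by rw [hxn, length_factor]
    have hf := h.eq_factor n
    rw [hlen] at hf
    have hf2 := (factor_eq_iff _ _ _ _ _).1 (hf.symm.trans hxn)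
    rcases lt_or_ge t (j - i) with hlt | hge
    · rw [hf2 t hlt, hi t ht]
    · have e1 : concatLen x n + t = concatLen x (n + 1) + (t - (j - i)) := by
        rw [concatLen_succ, hlen]; omega
      rw [e1, ih (t - (j - i)) (by omega) (n + 1) (by omega), ← hj (t - (j - i)) (by omega),
        ← hi t ht]
      congr 1
      omega

/-- If the occurrences of a prefix `p` of `ψ(v)` are the cuts at the occurrences of a prefix `q`
of `v`, then the return words to `p` are the images of the return words to `q`. -/
theorem returnWords_eq_image {ψ : Morph} (hne : NonErasing ψ) {v u : InfWord}
    (h : IsImage ψ v u) {m n : ℕ}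
    (hocc : ∀ j, IsOcc u (pref u m) j ↔ ∃ i, j = cut ψ v i ∧ IsOcc v (pref v n) i) :
    returnWords u (pref u m) = ψ '' returnWords v (pref v n) := by
  have hmono := hne.strictMono_cut v
  have hfac : ∀ i j, i < j → ψ (factor v i (j - i)) =
      factor u (cut ψ v i) (cut ψ v j - cut ψ v i) := fun i j hij => by
    rw [h.map_factor]
    congr 1
    conv_rhs => rw [← Nat.add_sub_cancel' hij.le]
    rw [cut_add]
    omega
  ext x
  constructor
  · rintro ⟨i, j, hij, hi, hj, hbet, rfl⟩
    obtain ⟨i', rfl, hi'⟩ := (hocc i).1 hi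
    obtain ⟨j', rfl, hj'⟩ := (hocc j).1 hj
    have hij' := hmono.lt_iff_lt.1 hij
    refine ⟨_, ⟨i', j', hij', hi', hj', fun t h1 h2 ht => ?_, rfl⟩, hfac _ _ hij'⟩
    exact hbet _ (hmono h1) (hmono h2) ((hocc _).2 ⟨t, rfl, ht⟩)
  · rintro ⟨y, ⟨i, j, hij, hi, hj, hbet, rfl⟩, rfl⟩
    refine ⟨cut ψ v i, cut ψ v j, hmono hij, (hocc _).2 ⟨i, rfl, hi⟩, (hocc _).2 ⟨j, rfl, hj⟩,
      fun t h1 h2 ht => ?_, hfac _ _ hij⟩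
    obtain ⟨t', rfl, ht'⟩ := (hocc t).1 ht
    exact hbet t' (hmono.lt_iff_lt.1 h1) (hmono.lt_iff_lt.1 h2) ht'

/-- Under the same assumptions, and if `ψ` is injective, the derivated words of `ψ(v)` with
respect to `p` are those of `v` with respect to `q`. -/
theorem isDerivated_iff {ψ : Morph} (hne : NonErasing ψ) (hinj : Function.Injective ψ)
    {v u : InfWord} (h : IsImage ψ v u) {m n : ℕ}
    (hocc : ∀ j, IsOcc u (pref u m) j ↔ ∃ i, j = cut ψ v i ∧ IsOcc v (pref v n) i)
    (d : ℕ → ℕ) :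
    IsDerivated u (pref u m) d ↔ IsDerivated v (pref v n) d := by
  have hret := returnWords_eq_image hne h hocc
  have hmono := hne.strictMono_cut v
  constructor
  · rintro ⟨k, r, s, hr, hrange, hcon, hd⟩
    have hmem : ∀ i, r i ∈ ψ '' returnWords v (pref v n) := fun i => by
      rw [← hret, ← hrange]; exact ⟨i, rfl⟩
    choose r' hr' hr'r using hmem
    refine ⟨k, r', s, fun i j hij => hr ?_, ?_, ?_, hd⟩
    · rw [← hr'r, ← hr'r, hij]
    · ext y
      constructor
      · rintro ⟨i, rfl⟩; exact hr' i
      · intro hy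
        have : ψ y ∈ Set.range r := by rw [hrange, hret]; exact ⟨y, hy, rfl⟩
        obtain ⟨i, hi⟩ := this
        exact ⟨i, hinj ((hr'r i).trans hi)⟩
    · have hocc' := fun n => (hcon.isOcc (m := m)
        (fun i => by rw [← hrange]; exact ⟨s i, rfl⟩) n)
      have hmap : ∀ N, ψ ((List.range N).map fun i => r' (s i)).prod =
          ((List.range N).map fun i => r (s i)).prod := fun N => by
        rw [map_list_prod, List.map_map]
        congr 1
        apply List.map_congr_left
        intro i _
        exact hr'r (s i)
      have key : ∀ N, ∃ i, ((List.range N).map fun i => r' (s i)).prod = pref v i := fun N => by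
        obtain ⟨i, hi, -⟩ := (hocc _).1 (hocc' N)
        refine ⟨i, hinj ?_⟩
        rw [hmap, hcon.prod_eq, hi, h.map_pref]
      refine ⟨fun N => ?_, fun M => ⟨M, ?_⟩⟩
      · obtain ⟨i, hi⟩ := key N
        rw [hi, length_pref]
      · have : StrictMono (concatLen fun i => r' (s i)) := strictMono_nat_of_lt_succ fun N => by
          rw [concatLen_succ]
          obtain ⟨a, b, hab, -, -, -, he⟩ := hr' (s N)
          rw [he, length_factor]
          omega
        exact this.le_apply
  · rintro ⟨k, r, s, hr, hrange, hcon, hd⟩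
    have hmap : ∀ N, ψ ((List.range N).map fun i => r (s i)).prod =
        ((List.range N).map fun i => ψ (r (s i))).prod := fun N => by
      rw [map_list_prod, List.map_map]
      rfl
    refine ⟨k, fun i => ψ (r i), s, hinj.comp hr, ?_, ⟨fun N => ?_, fun M => ?_⟩, hd⟩
    · rw [hret, ← hrange, ← Set.range_comp]
      rfl
    · rw [← hmap, hcon.prod_eq, h.map_pref, length_pref]
    · obtain ⟨N, hN⟩ := hcon.2 M
      refine ⟨N, hN.trans ?_⟩
      rw [← hmap]
      exact hne.length_le _

/-! ### Return words to the empty word -/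

/-- The word `u`, with its letters read as natural numbers, up to a permutation of letters. -/
def letterClass (u : InfWord) : Quotient permSetoid := Quotient.mk permSetoid fun i => (u i : ℕ)

/-- Both letters occur in `u`. -/
def Full (u : InfWord) : Prop := ∀ c, ∃ i, u i = c

theorem isOcc_one (u : InfWord) (i : ℕ) : IsOcc u (pref u 0) i := by
  rw [isOcc_pref_iff]; simp

theorem returnWords_one {u : InfWord} (hu : Full u) :
    returnWords u (pref u 0) = Set.range of := by
  ext x
  constructor
  · rintro ⟨i, j, hij, -, -, hbet, rfl⟩
    have : j - i = 1 := by
      by_contra hne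
      exact hbet (i + 1) (by omega) (by omega) (isOcc_one u _)
    exact ⟨u i, by rw [this, factor_one]⟩
  · rintro ⟨c, rfl⟩
    obtain ⟨i, rfl⟩ := hu c
    refine ⟨i, i + 1, by omega, isOcc_one u _, isOcc_one u _, fun t _ _ => by omega, ?_⟩
    rw [Nat.add_sub_cancel_left, factor_one]

theorem isDerivated_one {u : InfWord} (hu : Full u) :
    IsDerivated u (pref u 0) fun i => (u i : ℕ) := by
  refine ⟨2, of, u, of_injective, (returnWords_one hu).symm, ?_, fun _ => rfl⟩
  have : ∀ n, ((List.range n).map fun i => of (u i)).prod = pref u n := fun n => by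
    induction n with
    | zero => simp
    | succ n ih => rw [prod_range_succ, ih, pref_succ]
  exact ⟨fun n => by rw [this, length_pref], fun m => ⟨m, by rw [this, length_pref]⟩⟩

theorem mk_eq_of_isDerivated_one {u : InfWord} (hu : Full u) {d : ℕ → ℕ}
    (hd : IsDerivated u (pref u 0) d) : Quotient.mk permSetoid d = letterClass u := by
  obtain ⟨k, r, s, hr, hrange, hcon, hds⟩ := hd
  rw [returnWords_one hu] at hrange
  have hk : k = 2 := by
    have h1 := Set.ncard_range_of_injective hr
    rw [hrange, Set.ncard_range_of_injective of_injective] at h1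
    simpa using h1.symm
  subst hk
  have hmem : ∀ i, ∃ c, of c = r i := fun i => by
    have : r i ∈ Set.range of := by rw [← hrange]; exact ⟨i, rfl⟩
    exact this
  choose f hf using hmem
  have hfinj : Function.Injective f := fun i j hij => hr (by rw [← hf, ← hf, hij])
  have hlen : ∀ n, concatLen (fun i => r (s i)) n = n := fun n => by
    induction n with
    | zero => exact concatLen_zero _
    | succ n ih => rw [concatLen_succ, ih, ← hf, length_of]
  have hus : ∀ n, f (s n) = u n := fun n => by
    have := hcon.eq_factor n
    rw [hlen, ← hf, length_of, factor_one] at this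
    exact of_injective this
  let σ : Equiv.Perm (Fin 2) := Equiv.ofBijective f (Finite.injective_iff_bijective.1 hfinj)
  refine Quotient.sound ⟨σ.viaFintypeEmbedding Fin.valEmbedding, fun i => ?_⟩
  have := σ.viaFintypeEmbedding_apply_image Fin.valEmbedding (s i)
  rw [hds]
  exact (congrArg (fun c : Fin 2 => (c : ℕ)) (hus i).symm).trans this.symm

/-! ### Prefixes of images under the elementary morphisms -/

theorem isOcc_pref_succ (u : InfWord) (m j : ℕ) :
    IsOcc u (pref u (m + 1)) j ↔ IsOcc u (pref u m) j ∧ u (j + m) = u m := by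
  simp only [isOcc_pref_iff]
  constructor
  · exact fun h => ⟨fun t ht => h t (by omega), h m (by omega)⟩
  · rintro ⟨h1, h2⟩ t ht
    rcases Nat.lt_succ_iff_lt_or_eq.1 ht with h | rfl
    · exact h1 t h
    · exact h2

theorem cut_add_of_isOcc (ψ : Morph) {v : InfWord} {n i : ℕ} (h : IsOcc v (pref v n) i) :
    cut ψ v (i + n) = cut ψ v i + cut ψ v n := by
  unfold IsOcc at h
  rw [length_pref] at h
  rw [cut_add, h]
  rfl

/-- The occurrences of the prefix of `u` of length `m` are the cuts at the occurrences of the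
prefix of `v` of length `n`. -/
def OccMatch (ψ : Morph) (v u : InfWord) (m n : ℕ) : Prop :=
  ∀ j, IsOcc u (pref u m) j ↔ ∃ i, j = cut ψ v i ∧ IsOcc v (pref v n) i

theorem NonErasing.exists_cut {ψ : Morph} (h : NonErasing ψ) (v : InfWord) {m : ℕ} (hm : 0 < m) :
    ∃ n, cut ψ v n < m ∧ m ≤ cut ψ v (n + 1) := by
  have hmono := h.strictMono_cut v
  have hex : ∃ n, m ≤ cut ψ v n := ⟨m, hmono.le_apply⟩
  classical
  have h0 : Nat.find hex ≠ 0 := fun h0 => by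
    have := Nat.find_spec hex
    rw [h0, cut_zero] at this
    omega
  refine ⟨Nat.find hex - 1, ?_, ?_⟩
  · exact not_le.1 (Nat.find_min hex (by omega))
  · rw [Nat.sub_add_cancel (by omega)]
    exact Nat.find_spec hex

/-! ### Morphisms `x ↦ x`, `y ↦ xy`: the letters `b`, `β` -/

section Left

variable {ψ : Morph} {x y : Fin 2} {v u : InfWord}

theorem nonErasing_of_left (hxy : ∀ c, c = x ∨ c = y) (hx : ψ (of x) = of x)
    (hy : ψ (of y) = of x * of y) : NonErasing ψ := fun c => by
  rcases hxy c with rfl | rfl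
  · rw [hx]; exact of_ne_one _
  · rw [hy]; exact fun h => absurd (congrArg FreeMonoid.length h) (by simp)

theorem injective_of_left (hxy : ∀ c, c = x ∨ c = y) (hne : x ≠ y) (hx : ψ (of x) = of x)
    (hy : ψ (of y) = of x * of y) : Function.Injective ψ := by
  have hx' : ∀ s, ψ (of x * s) = of x * ψ s := fun s => by rw [map_mul, hx]
  have hy' : ∀ s, ψ (of y * s) = of x * (of y * ψ s) := fun s => by rw [map_mul, hy, mul_assoc]
  have hnot : ∀ s t, ψ s ≠ of y * t := fun s t h => by
    induction s using FreeMonoid.inductionOn' with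
    | one =>
      rw [map_one] at h
      exact absurd (congrArg FreeMonoid.length h) (by simp; omega)
    | of_mul c s ih =>
      rcases hxy c with rfl | rfl
      · rw [hx'] at h; exact hne (List.cons.inj h).1
      · rw [hy'] at h; exact hne (List.cons.inj h).1
  have hone : ∀ s, ψ s = 1 → s = 1 := fun s h => by
    have := (nonErasing_of_left hxy hx hy).length_le s
    rw [h] at this
    exact length_eq_zero.1 (by simpa using this)
  intro s
  induction s using FreeMonoid.inductionOn' with
  | one => intro t h; rw [map_one] at h; exact (hone t h.symm).symm
  | of_mul c s ih =>
    intro t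
    induction t using FreeMonoid.inductionOn' with
    | one => intro h; rw [map_one] at h; exact hone _ h
    | of_mul d t _ =>
      intro h
      rcases hxy c with rfl | rfl <;> rcases hxy d with rfl | rfl
      · rw [hx', hx'] at h; rw [ih (mul_left_cancel h)]
      · rw [hx', hy'] at h; exact absurd (mul_left_cancel h) (hnot _ _)
      · rw [hx', hy'] at h; exact absurd (mul_left_cancel h).symm (hnot _ _)
      · rw [hy', hy'] at h; rw [ih (mul_left_cancel (mul_left_cancel h))]

theorem cut_left_x (hx : ψ (of x) = of x) {i : ℕ} (hi : v i = x) :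
    cut ψ v (i + 1) = cut ψ v i + 1 := by
  rw [cut_succ, hi, hx, length_of]

theorem cut_left_y (hy : ψ (of y) = of x * of y) {i : ℕ} (hi : v i = y) :
    cut ψ v (i + 1) = cut ψ v i + 2 := by
  rw [cut_succ, hi, hy, length_mul, length_of, length_of]

theorem left_apply_cut (hxy : ∀ c, c = x ∨ c = y) (hx : ψ (of x) = of x)
    (hy : ψ (of y) = of x * of y) (h : IsImage ψ v u) (i : ℕ) : u (cut ψ v i) = x := by
  have := h.map_of i
  rcases hxy (v i) with hi | hi
  · rw [hi, hx, length_of, factor_one] at this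
    exact (of_injective this).symm
  · rw [hi, hy, length_mul, length_of, length_of, factor_add, factor_one] at this
    exact (List.cons.inj this).1.symm

theorem left_apply_cut_succ (hy : ψ (of y) = of x * of y) (h : IsImage ψ v u) {i : ℕ}
    (hi : v i = y) : u (cut ψ v i + 1) = y := by
  have := h.map_of i
  rw [hi, hy, length_mul, length_of, length_of, factor_add, factor_one, factor_one] at this
  exact (of_injective (mul_eq_mul_of_length this rfl).2).symm

theorem left_exists_cut (hxy : ∀ c, c = x ∨ c = y) (hne : x ≠ y) (hx : ψ (of x) = of x)
    (hy : ψ (of y) = of x * of y) (h : IsImage ψ v u) {j : ℕ} (hj : u j = x) :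
    ∃ i, j = cut ψ v i := by
  obtain ⟨i, hi1, hi2⟩ := (nonErasing_of_left hxy hx hy).exists_cut v (Nat.succ_pos j)
  refine ⟨i, ?_⟩
  rcases hxy (v i) with hi | hi
  · rw [cut_left_x hx hi] at hi2; omega
  · rw [cut_left_y hy hi] at hi2
    by_contra hc
    have : j = cut ψ v i + 1 := by omega
    rw [this, left_apply_cut_succ hy h hi] at hj
    exact hne hj.symm

/-- A block is either the single letter `x`, followed by the first letter `x` of the next block, or
`xy`; so the letter after a cut is the letter of `v` itself. -/
theorem left_next (hxy : ∀ c, c = x ∨ c = y) (hx : ψ (of x) = of x)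
    (hy : ψ (of y) = of x * of y) (h : IsImage ψ v u) (i : ℕ) :
    u (cut ψ v i + 1) = v i := by
  rcases hxy (v i) with hi | hi
  · rw [← cut_left_x hx hi, left_apply_cut hxy hx hy h, hi]
  · rw [left_apply_cut_succ hy h hi, hi]

theorem left_occ_aux (hxy : ∀ c, c = x ∨ c = y) (hx : ψ (of x) = of x)
    (hy : ψ (of y) = of x * of y) (h : IsImage ψ v u) {n : ℕ}
    (hn : OccMatch ψ v u (cut ψ v n + 1) n) : OccMatch ψ v u (cut ψ v n + 2) (n + 1) := fun j => by
  rw [isOcc_pref_succ, hn j]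
  constructor
  · rintro ⟨⟨i, rfl, hi⟩, hu⟩
    refine ⟨i, rfl, (isOcc_pref_succ _ _ _).2 ⟨hi, ?_⟩⟩
    rw [← left_next hxy hx hy h, ← left_next hxy hx hy h, cut_add_of_isOcc ψ hi, ← hu, add_assoc]
  · rintro ⟨i, rfl, hi⟩
    obtain ⟨hi, hv⟩ := (isOcc_pref_succ _ _ _).1 hi
    refine ⟨⟨i, rfl, hi⟩, ?_⟩
    rw [← left_next hxy hx hy h, ← left_next hxy hx hy h, cut_add_of_isOcc ψ hi] at hv
    rw [← hv, add_assoc]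

/-- The image of a prefix of `v` is always followed by `x`. The prefix of `u` made of both occurs
exactly at the cuts at the occurrences of the prefix of `v`. -/
theorem left_occ (hxy : ∀ c, c = x ∨ c = y) (hne : x ≠ y) (hx : ψ (of x) = of x)
    (hy : ψ (of y) = of x * of y) (h : IsImage ψ v u) (n : ℕ) :
    OccMatch ψ v u (cut ψ v n + 1) n := by
  induction n with
  | zero =>
    intro j
    have hu0 : u 0 = x := by simpa using left_apply_cut hxy hx hy h 0
    rw [isOcc_pref_iff]
    constructor
    · intro hj
      obtain ⟨i, hi⟩ := left_exists_cut hxy hne hx hy h ((hj 0 (by simp)).trans hu0)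
      exact ⟨i, hi, isOcc_one v i⟩
    · rintro ⟨i, rfl, -⟩ t ht
      obtain rfl : t = 0 := by simpa using ht
      rw [add_zero, left_apply_cut hxy hx hy h, hu0]
  | succ n ih =>
    have h2 := left_occ_aux hxy hx hy h ih
    rcases hxy (v n) with hn | hn
    · rw [cut_left_x hx hn]
      exact h2
    · rw [cut_left_y hy hn]
      intro j
      rw [isOcc_pref_succ, h2 j]
      refine and_iff_left_of_imp ?_
      rintro ⟨i, rfl, hi⟩
      have := cut_add_of_isOcc ψ hi
      rw [cut_left_y hy hn] at this
      rw [← this, ← cut_left_y hy hn, left_apply_cut hxy hx hy h, left_apply_cut hxy hx hy h]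

/-- Every nonempty prefix of `u` corresponds to a strictly shorter prefix of `v`. -/
theorem left_match (hxy : ∀ c, c = x ∨ c = y) (hne : x ≠ y) (hx : ψ (of x) = of x)
    (hy : ψ (of y) = of x * of y) (h : IsImage ψ v u) {m : ℕ} (hm : 0 < m) :
    ∃ n < m, OccMatch ψ v u m n := by
  have hner := nonErasing_of_left hxy hx hy
  obtain ⟨n, h1, h2⟩ := hner.exists_cut v hm
  have hle : n ≤ cut ψ v n := (hner.strictMono_cut v).le_apply
  have h3 : m = cut ψ v n + 1 ∨ m = cut ψ v n + 2 := by
    rcases hxy (v n) with hn | hn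
    · rw [cut_left_x hx hn] at h2; omega
    · rw [cut_left_y hy hn] at h2; omega
  rcases h3 with rfl | rfl
  · exact ⟨n, by omega, left_occ hxy hne hx hy h n⟩
  · exact ⟨n + 1, by omega, left_occ_aux hxy hx hy h (left_occ hxy hne hx hy h n)⟩

end Left

/-! ### Morphisms `x ↦ x`, `y ↦ yx`: the letters `a`, `α` -/

section Right

variable {ψ : Morph} {x y : Fin 2} {v u : InfWord}

theorem nonErasing_of_right (hxy : ∀ c, c = x ∨ c = y) (hx : ψ (of x) = of x)
    (hy : ψ (of y) = of y * of x) : NonErasing ψ := fun c => by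
  rcases hxy c with rfl | rfl
  · rw [hx]; exact of_ne_one _
  · rw [hy]; exact fun h => absurd (congrArg FreeMonoid.length h) (by simp)

theorem injective_of_right (hxy : ∀ c, c = x ∨ c = y) (hne : x ≠ y) (hx : ψ (of x) = of x)
    (hy : ψ (of y) = of y * of x) : Function.Injective ψ := by
  have hx' : ∀ s, ψ (of x * s) = of x * ψ s := fun s => by rw [map_mul, hx]
  have hy' : ∀ s, ψ (of y * s) = of y * (of x * ψ s) := fun s => by rw [map_mul, hy, mul_assoc]
  have hone : ∀ s, ψ s = 1 → s = 1 := fun s h => by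
    have := (nonErasing_of_right hxy hx hy).length_le s
    rw [h] at this
    exact length_eq_zero.1 (by simpa using this)
  intro s
  induction s using FreeMonoid.inductionOn' with
  | one => intro t h; rw [map_one] at h; exact (hone t h.symm).symm
  | of_mul c s ih =>
    intro t
    induction t using FreeMonoid.inductionOn' with
    | one => intro h; rw [map_one] at h; exact hone _ h
    | of_mul d t _ =>
      intro h
      rcases hxy c with rfl | rfl <;> rcases hxy d with rfl | rfl
      · rw [hx', hx'] at h; rw [ih (mul_left_cancel h)]
      · rw [hx', hy'] at h; exact absurd (List.cons.inj h).1 hne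
      · rw [hx', hy'] at h; exact absurd (List.cons.inj h).1.symm hne
      · rw [hy', hy'] at h; rw [ih (mul_left_cancel (mul_left_cancel h))]

theorem cut_right_y (hy : ψ (of y) = of y * of x) {i : ℕ} (hi : v i = y) :
    cut ψ v (i + 1) = cut ψ v i + 2 := by
  rw [cut_succ, hi, hy, length_mul, length_of, length_of]

theorem right_apply_cut (hxy : ∀ c, c = x ∨ c = y) (hx : ψ (of x) = of x)
    (hy : ψ (of y) = of y * of x) (h : IsImage ψ v u) (i : ℕ) : u (cut ψ v i) = v i := by
  have := h.map_of i
  rcases hxy (v i) with hi | hi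
  · rw [hi, hx, length_of, factor_one] at this
    rw [hi]; exact (of_injective this).symm
  · rw [hi, hy, length_mul, length_of, length_of, factor_add, factor_one] at this
    rw [hi]; exact (List.cons.inj this).1.symm

theorem right_apply_cut_succ (hy : ψ (of y) = of y * of x) (h : IsImage ψ v u) {i : ℕ}
    (hi : v i = y) : u (cut ψ v i + 1) = x := by
  have := h.map_of i
  rw [hi, hy, length_mul, length_of, length_of, factor_add, factor_one, factor_one] at this
  exact (of_injective (mul_eq_mul_of_length this rfl).2).symm

theorem right_exists_cut (hxy : ∀ c, c = x ∨ c = y) (hne : x ≠ y) (hx : ψ (of x) = of x)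
    (hy : ψ (of y) = of y * of x) (h : IsImage ψ v u) {j : ℕ} (hj : u j = y) :
    ∃ i, j = cut ψ v i := by
  obtain ⟨i, hi1, hi2⟩ := (nonErasing_of_right hxy hx hy).exists_cut v (Nat.succ_pos j)
  refine ⟨i, ?_⟩
  rcases hxy (v i) with hi | hi
  · rw [cut_left_x hx hi] at hi2; omega
  · rw [cut_right_y hy hi] at hi2
    by_contra hc
    have : j = cut ψ v i + 1 := by omega
    rw [this, right_apply_cut_succ hy h hi] at hj
    exact hne hj

theorem right_occ_block (hxy : ∀ c, c = x ∨ c = y) (hx : ψ (of x) = of x)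
    (hy : ψ (of y) = of y * of x) (h : IsImage ψ v u) {n : ℕ}
    (hn : OccMatch ψ v u (cut ψ v n + 1) (n + 1)) :
    OccMatch ψ v u (cut ψ v (n + 1)) (n + 1) := by
  rcases hxy (v n) with hvn | hvn
  · rw [cut_left_x hx hvn]
    exact hn
  · intro j
    rw [cut_right_y hy hvn, isOcc_pref_succ, hn j]
    refine and_iff_left_of_imp ?_
    rintro ⟨i, rfl, hi⟩
    obtain ⟨hi, hv⟩ := (isOcc_pref_succ _ _ _).1 hi
    rw [← add_assoc, ← cut_add_of_isOcc ψ hi, right_apply_cut_succ hy h (hv.trans hvn),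
      right_apply_cut_succ hy h hvn]

theorem right_occ_letter (hxy : ∀ c, c = x ∨ c = y) (hx : ψ (of x) = of x)
    (hy : ψ (of y) = of y * of x) (h : IsImage ψ v u) {n : ℕ}
    (hn : OccMatch ψ v u (cut ψ v n) n) :
    OccMatch ψ v u (cut ψ v n + 1) (n + 1) := fun j => by
  rw [isOcc_pref_succ, hn j]
  constructor
  · rintro ⟨⟨i, rfl, hi⟩, hu⟩
    refine ⟨i, rfl, (isOcc_pref_succ _ _ _).2 ⟨hi, ?_⟩⟩
    rw [← right_apply_cut hxy hx hy h, ← right_apply_cut hxy hx hy h, cut_add_of_isOcc ψ hi, hu]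
  · rintro ⟨i, rfl, hi⟩
    obtain ⟨hi, hv⟩ := (isOcc_pref_succ _ _ _).1 hi
    refine ⟨⟨i, rfl, hi⟩, ?_⟩
    rwa [← right_apply_cut hxy hx hy h, ← right_apply_cut hxy hx hy h,
      cut_add_of_isOcc ψ hi] at hv

/-- If `v` starts with `y`, so does `u`, and every `y` in `u` starts a block. Hence the occurrences
of a nonempty prefix of `u` are cuts; here the prefix ends with the first letter of a block, which
determines the block. -/
theorem right_occ (hxy : ∀ c, c = x ∨ c = y) (hne : x ≠ y) (hx : ψ (of x) = of x)
    (hy : ψ (of y) = of y * of x) (h : IsImage ψ v u) (hv : v 0 = y) (n : ℕ) :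
    OccMatch ψ v u (cut ψ v n + 1) (n + 1) := by
  induction n with
  | zero =>
    intro j
    have hu0 : u 0 = y := by simpa [hv] using right_apply_cut hxy hx hy h 0
    rw [isOcc_pref_iff]
    constructor
    · intro hj
      have huj := (hj 0 (by simp)).trans hu0
      obtain ⟨i, rfl⟩ := right_exists_cut hxy hne hx hy h huj
      refine ⟨i, rfl, (isOcc_pref_iff _ _ _).2 fun t ht => ?_⟩
      obtain rfl : t = 0 := by simpa using ht
      rw [add_zero, right_apply_cut hxy hx hy h] at huj
      rw [add_zero, huj, hv]
    · rintro ⟨i, rfl, hi⟩ t ht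
      obtain rfl : t = 0 := by simpa using ht
      have := (isOcc_pref_iff _ _ _).1 hi 0 (by simp)
      rw [add_zero] at this
      rw [add_zero, right_apply_cut hxy hx hy h, this, hu0, hv]
  | succ n ih => exact right_occ_letter hxy hx hy h (right_occ_block hxy hx hy h ih)

/-- Every nonempty prefix of `u` corresponds to a nonempty prefix of `v` that is not longer. -/
theorem right_match (hxy : ∀ c, c = x ∨ c = y) (hne : x ≠ y) (hx : ψ (of x) = of x)
    (hy : ψ (of y) = of y * of x) (h : IsImage ψ v u) (hv : v 0 = y) {m : ℕ} (hm : 0 < m) :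
    ∃ n, 0 < n ∧ n ≤ m ∧ OccMatch ψ v u m n := by
  have hner := nonErasing_of_right hxy hx hy
  obtain ⟨n, h1, h2⟩ := hner.exists_cut v hm
  have hle : n ≤ cut ψ v n := (hner.strictMono_cut v).le_apply
  have h3 : m = cut ψ v n + 1 ∨ m = cut ψ v (n + 1) := by
    rcases hxy (v n) with hn | hn
    · rw [cut_left_x hx hn] at h2 ⊢; omega
    · rw [cut_right_y hy hn] at h2 ⊢; omega
  refine ⟨n + 1, by omega, by omega, ?_⟩
  rcases h3 with rfl | rfl
  · exact right_occ hxy hne hx hy h hv n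
  · exact right_occ_block hxy hx hy h (right_occ hxy hne hx hy h hv n)

end Right

/-! ### Derivated words of images under the elementary morphisms -/

/-- The classes of derivated words with respect to nonempty prefixes of length at most `m`. -/
def DerLE (m : ℕ) (u : InfWord) : Set (Quotient permSetoid) :=
  {q | ∃ n d, 0 < n ∧ n ≤ m ∧ IsDerivated u (pref u n) d ∧ q = Quotient.mk permSetoid d}

theorem DerLE_zero (u : InfWord) : DerLE 0 u = ∅ := by
  ext q
  simp only [DerLE, Set.mem_ofPred_eq, Set.mem_empty_iff_false, iff_false]
  rintro ⟨n, d, h1, h2, -⟩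
  omega

theorem mem_Der_iff (u : InfWord) (q : Quotient permSetoid) : q ∈ Der u ↔ ∃ m, q ∈ DerLE m u := by
  constructor
  · rintro ⟨m, d, h1, h2⟩; exact ⟨m, m, d, h1, le_rfl, h2⟩
  · rintro ⟨m, n, d, h1, -, h2⟩; exact ⟨n, d, h1, h2⟩

theorem DerLE_subset_insert {ψ : Morph} (hne : NonErasing ψ) (hinj : Function.Injective ψ)
    {v u : InfWord} (h : IsImage ψ v u) (hv : Full v)
    (hm : ∀ m, 0 < m → ∃ n < m, OccMatch ψ v u m n) (m : ℕ) :
    DerLE m u ⊆ insert (letterClass v) (DerLE (m - 1) v) := by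
  rintro q ⟨k, d, h1, h2, h3, rfl⟩
  obtain ⟨n, hnk, hocc⟩ := hm k h1
  have hd := (isDerivated_iff hne hinj h hocc d).1 h3
  rcases Nat.eq_zero_or_pos n with rfl | hn
  · exact Or.inl (mk_eq_of_isDerivated_one hv hd)
  · exact Or.inr ⟨n, d, hn, by omega, hd, rfl⟩

theorem insert_subset_Der {ψ : Morph} (hne : NonErasing ψ) (hinj : Function.Injective ψ)
    {v u : InfWord} (h : IsImage ψ v u) (hv : Full v)
    (hm : ∀ n, ∃ m, 0 < m ∧ OccMatch ψ v u m n) :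
    insert (letterClass v) (Der v) ⊆ Der u := by
  rintro q (rfl | ⟨n, d, -, hd, rfl⟩)
  · obtain ⟨m, hm0, hocc⟩ := hm 0
    exact ⟨m, _, hm0, (isDerivated_iff hne hinj h hocc _).2 (isDerivated_one hv), rfl⟩
  · obtain ⟨m, hm0, hocc⟩ := hm n
    exact ⟨m, d, hm0, (isDerivated_iff hne hinj h hocc d).2 hd, rfl⟩

theorem DerLE_subset_of_match {ψ : Morph} (hne : NonErasing ψ) (hinj : Function.Injective ψ)
    {v u : InfWord} (h : IsImage ψ v u)
    (hm : ∀ m, 0 < m → ∃ n, 0 < n ∧ n ≤ m ∧ OccMatch ψ v u m n) (m : ℕ) :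
    DerLE m u ⊆ DerLE m v := by
  rintro q ⟨k, d, h1, h2, h3, rfl⟩
  obtain ⟨n, hn, hnk, hocc⟩ := hm k h1
  exact ⟨n, d, hn, hnk.trans h2, (isDerivated_iff hne hinj h hocc d).1 h3, rfl⟩

theorem Der_subset_of_match {ψ : Morph} (hne : NonErasing ψ) (hinj : Function.Injective ψ)
    {v u : InfWord} (h : IsImage ψ v u)
    (hm : ∀ n, 0 < n → ∃ m, 0 < m ∧ OccMatch ψ v u m n) :
    Der v ⊆ Der u := by
  rintro q ⟨n, d, hn, hd, rfl⟩
  obtain ⟨m, hm0, hocc⟩ := hm n hn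
  exact ⟨m, d, hm0, (isDerivated_iff hne hinj h hocc d).2 hd, rfl⟩

/-- The letters `b` and `β`, whose morphisms put the same letter in front of each block. -/
def Gen.isOne : Gen → Bool
  | .a => false
  | .b => true
  | .α => false
  | .β => true

/-- The letters `a` and `b`. -/
def Gen.isLatin : Gen → Bool
  | .a => true
  | .b => true
  | .α => false
  | .β => false

/-- The letter fixed by the elementary morphism. -/
def Gen.fixed : Gen → Fin 2
  | .a => 0
  | .b => 0
  | .α => 1
  | .β => 1

/-- The letter not fixed by the elementary morphism. -/
def Gen.moved : Gen → Fin 2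
  | .a => 1
  | .b => 1
  | .α => 0
  | .β => 0

theorem Gen.eq_fixed_or (g : Gen) (c : Fin 2) : c = g.fixed ∨ c = g.moved := by
  cases g <;> fin_cases c <;> simp [Gen.fixed, Gen.moved]

theorem Gen.fixed_ne (g : Gen) : g.fixed ≠ g.moved := by
  cases g <;> simp [Gen.fixed, Gen.moved]

theorem elem_fixed (g : Gen) : elem g (of g.fixed) = of g.fixed := by
  cases g <;> rfl

theorem elem_moved_of_one {g : Gen} (hg : g.isOne) :
    elem g (of g.moved) = of g.fixed * of g.moved := by
  cases g
  · simp [Gen.isOne] at hg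
  · rfl
  · simp [Gen.isOne] at hg
  · rfl

theorem elem_moved_of_not_one {g : Gen} (hg : g.isOne = false) :
    elem g (of g.moved) = of g.moved * of g.fixed := by
  cases g
  · rfl
  · simp [Gen.isOne] at hg
  · rfl
  · simp [Gen.isOne] at hg

theorem nonErasing_elem (g : Gen) : NonErasing (elem g) := by
  cases hg : g.isOne
  · exact nonErasing_of_right g.eq_fixed_or (elem_fixed g) (elem_moved_of_not_one hg)
  · exact nonErasing_of_left g.eq_fixed_or (elem_fixed g) (elem_moved_of_one hg)

theorem injective_elem (g : Gen) : Function.Injective (elem g) := by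
  cases hg : g.isOne
  · exact injective_of_right g.eq_fixed_or g.fixed_ne (elem_fixed g) (elem_moved_of_not_one hg)
  · exact injective_of_left g.eq_fixed_or g.fixed_ne (elem_fixed g) (elem_moved_of_one hg)

theorem DerLE_elem_one {g : Gen} (hg : g.isOne) {v : InfWord} (hv : Full v) (m : ℕ) :
    DerLE m (image (elem g) v) ⊆ insert (letterClass v) (DerLE (m - 1) v) := by
  have h := isImage_image (nonErasing_elem g) v
  exact DerLE_subset_insert (nonErasing_elem g) (injective_elem g) h hv
    (fun m hm => left_match g.eq_fixed_or g.fixed_ne (elem_fixed g) (elem_moved_of_one hg) h hm) m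

theorem Der_elem_one {g : Gen} (hg : g.isOne) {v : InfWord} (hv : Full v) :
    Der (image (elem g) v) = insert (letterClass v) (Der v) := by
  have h := isImage_image (nonErasing_elem g) v
  apply Set.Subset.antisymm
  · intro q hq
    obtain ⟨m, hm⟩ := (mem_Der_iff _ _).1 hq
    exact (DerLE_elem_one hg hv m hm).imp_right fun h => (mem_Der_iff _ _).2 ⟨_, h⟩
  · exact insert_subset_Der (nonErasing_elem g) (injective_elem g) h hv fun n =>
      ⟨cut (elem g) v n + 1, Nat.succ_pos _,
        left_occ g.eq_fixed_or g.fixed_ne (elem_fixed g) (elem_moved_of_one hg) h n⟩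

theorem DerLE_elem_zero {g : Gen} (hg : g.isOne = false) {v : InfWord} (hv : v 0 = g.moved)
    (m : ℕ) : DerLE m (image (elem g) v) ⊆ DerLE m v := by
  have h := isImage_image (nonErasing_elem g) v
  exact DerLE_subset_of_match (nonErasing_elem g) (injective_elem g) h
    (fun m hm => right_match g.eq_fixed_or g.fixed_ne (elem_fixed g) (elem_moved_of_not_one hg) h
      hv hm) m

theorem Der_elem_zero {g : Gen} (hg : g.isOne = false) {v : InfWord} (hv : v 0 = g.moved) :
    Der (image (elem g) v) = Der v := by
  have h := isImage_image (nonErasing_elem g) v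
  apply Set.Subset.antisymm
  · intro q hq
    obtain ⟨m, hm⟩ := (mem_Der_iff _ _).1 hq
    exact (mem_Der_iff _ _).2 ⟨m, DerLE_elem_zero hg hv m hm⟩
  · refine Der_subset_of_match (nonErasing_elem g) (injective_elem g) h fun n hn => ?_
    obtain ⟨n, rfl⟩ := Nat.exists_eq_succ_of_ne_zero hn.ne'
    exact ⟨cut (elem g) v n + 1, Nat.succ_pos _,
      right_occ g.eq_fixed_or g.fixed_ne (elem_fixed g) (elem_moved_of_not_one hg) h hv n⟩

/-! ### Names and directive words -/

@[simp] theorem phi_nil : phi [] = 1 := rfl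

@[simp] theorem phi_cons (c : Gen) (x : List Gen) : phi (c :: x) = elem c * phi x := by
  simp [phi]

@[simp] theorem phi_append (x y : List Gen) : phi (x ++ y) = phi x * phi y := by
  simp [phi]

theorem nonErasing_phi (x : List Gen) : NonErasing (phi x) := by
  induction x with
  | nil => exact NonErasing.one
  | cons c x ih => rw [phi_cons]; exact (nonErasing_elem c).mul ih

/-- The infinite word `φ_x(v)`. -/
def act (x : List Gen) (v : InfWord) : InfWord := image (phi x) v

@[simp] theorem act_nil (v : InfWord) : act [] v = v := image_one v

theorem act_cons (c : Gen) (x : List Gen) (v : InfWord) :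
    act (c :: x) v = image (elem c) (act x v) := by
  rw [act, phi_cons, image_mul (nonErasing_elem c) (nonErasing_phi x)]
  rfl

theorem act_append (x y : List Gen) (v : InfWord) : act (x ++ y) v = act x (act y v) := by
  rw [act, phi_append, image_mul (nonErasing_phi x) (nonErasing_phi y)]
  rfl

theorem act_congr {x y : List Gen} (h : phi x = phi y) (v : InfWord) : act x v = act y v := by
  rw [act, h, act]

theorem isImage_act (x : List Gen) (v : InfWord) : IsImage (phi x) v (act x v) :=
  isImage_image (nonErasing_phi x) v

theorem isFixedPoint_iff (x : List Gen) (u : InfWord) : IsFixedPoint (phi x) u ↔ act x u = u := by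
  constructor
  · exact fun h => image_eq (nonErasing_phi x) h
  · intro h
    have := isImage_act x u
    rwa [h] at this

/-- The first letter of `φ_x(v)` if `v` starts with `l`: the first letter of `x` among `b`, `β`
determines it. -/
def first : List Gen → Fin 2 → Fin 2
  | [], l => l
  | .b :: _, _ => 0
  | .β :: _, _ => 1
  | .a :: x, l => first x l
  | .α :: x, l => first x l

theorem first_append (x y : List Gen) (l : Fin 2) : first (x ++ y) l = first x (first y l) := by
  induction x with
  | nil => rfl
  | cons c x ih => cases c <;> simp [first, ih]

theorem elem_apply_zero (g : Gen) (v : InfWord) :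
    image (elem g) v 0 = if g.isOne then g.fixed else v 0 := by
  have h := isImage_image (nonErasing_elem g) v
  cases hg : g.isOne
  · simpa using right_apply_cut g.eq_fixed_or (elem_fixed g) (elem_moved_of_not_one hg) h 0
  · simpa using left_apply_cut g.eq_fixed_or (elem_fixed g) (elem_moved_of_one hg) h 0

theorem act_apply_zero (x : List Gen) (v : InfWord) : act x v 0 = first x (v 0) := by
  induction x with
  | nil => simp [first]
  | cons c x ih =>
    rw [act_cons, elem_apply_zero, ih]
    cases c <;> simp [first, Gen.isOne, Gen.fixed]

theorem Full.image_elem (g : Gen) {v : InfWord} (hv : Full v) : Full (image (elem g) v) := by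
  intro c
  obtain ⟨i, rfl⟩ := hv c
  have h := isImage_image (nonErasing_elem g) v
  cases hg : g.isOne
  · exact ⟨_, right_apply_cut g.eq_fixed_or (elem_fixed g) (elem_moved_of_not_one hg) h i⟩
  · exact ⟨_, left_next g.eq_fixed_or (elem_fixed g) (elem_moved_of_one hg) h i⟩

theorem Full.act (x : List Gen) {v : InfWord} (hv : Full v) : Full (act x v) := by
  induction x with
  | nil => rwa [act_nil]
  | cons c x ih => rw [act_cons]; exact ih.image_elem c

/-- In `x`, every `a` is followed by a word `r` with `first r p = 1` and every `α` by a word `r`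
with `first r q = 0`. With `p = 1` and `q = 0` this says that `x` contains no factor `a α^k b` and
no factor `α a^k β`; with `p = q = v 0` it says moreover that in `φ_x(v)` each letter `a` is
applied to a word starting with `1`, and each letter `α` to a word starting with `0`. -/
def Admissible (p q : Fin 2) : List Gen → Prop
  | [] => True
  | .a :: x => first x p = 1 ∧ Admissible p q x
  | .α :: x => first x q = 0 ∧ Admissible p q x
  | .b :: x => Admissible p q x
  | .β :: x => Admissible p q x

theorem admissible_append (p q : Fin 2) (x y : List Gen) :
    Admissible p q (x ++ y) ↔ Admissible (first y p) (first y q) x ∧ Admissible p q y := by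
  induction x with
  | nil => simp [Admissible]
  | cons c x ih => cases c <;> simp [Admissible, ih, first_append, and_assoc]

/-- The classes of the words `φ_{x''}(v)` for the factorizations `x = x' c x''` with `c` one of
`b`, `β`. -/
def states : List Gen → InfWord → Set (Quotient permSetoid)
  | [], _ => ∅
  | c :: x, v => if c.isOne then insert (letterClass (act x v)) (states x v) else states x v

theorem states_finite (x : List Gen) (v : InfWord) : (states x v).Finite := by
  induction x with
  | nil => exact Set.finite_empty
  | cons c x ih =>
    unfold states
    split_ifs
    · exact ih.insert _
    · exact ih

theorem states_ncard_le (x : List Gen) (v : InfWord) :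
    (states x v).ncard ≤ x.countP Gen.isOne := by
  induction x with
  | nil => simp [states]
  | cons c x ih =>
    unfold states
    split_ifs with h
    · rw [List.countP_cons_of_pos h]
      exact (Set.ncard_insert_le _ _).trans (by omega)
    · rw [List.countP_cons_of_neg h]
      exact ih

theorem states_nonempty {x : List Gen} (hx : 0 < x.countP Gen.isOne) (v : InfWord) :
    (states x v).Nonempty := by
  induction x with
  | nil => simp at hx
  | cons c x ih =>
    unfold states
    split_ifs with h
    · exact Set.insert_nonempty _ _
    · rw [List.countP_cons_of_neg h] at hx
      exact ih hx

theorem states_append (x y : List Gen) (v : InfWord) :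
    states (x ++ y) v = states x (act y v) ∪ states y v := by
  induction x with
  | nil => simp [states]
  | cons c x ih =>
    simp only [List.cons_append, states, ih, act_append]
    split_ifs
    · rw [Set.insert_union]
    · rfl

/-- The length of the prefixes drops with each letter `b`, `β` of `x`; this bounds the derivated
words of a fixed point, for which `Der_act` alone is circular. -/
theorem DerLE_act {x : List Gen} {v : InfWord} (hv : Full v) (hx : Admissible (v 0) (v 0) x)
    (m : ℕ) : DerLE m (act x v) ⊆ states x v ∪ DerLE (m - x.countP Gen.isOne) v := by
  induction x generalizing m with
  | nil => simp [states]
  | cons c x ih =>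
    have hfull := hv.act x
    have hone : c.isOne → Admissible (v 0) (v 0) x →
        DerLE m (act (c :: x) v) ⊆
          states (c :: x) v ∪ DerLE (m - (c :: x).countP Gen.isOne) v := fun hc hx => by
      rw [act_cons, states, if_pos hc, List.countP_cons_of_pos hc]
      refine (DerLE_elem_one hc hfull m).trans ?_
      rw [Set.insert_union]
      refine Set.insert_subset_insert ((ih hx (m - 1)).trans ?_)
      rw [Nat.sub_sub, Nat.add_comm 1]
    have hzero : c.isOne = false → act x v 0 = c.moved → Admissible (v 0) (v 0) x →
        DerLE m (act (c :: x) v) ⊆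
          states (c :: x) v ∪ DerLE (m - (c :: x).countP Gen.isOne) v := fun hc h0 hx => by
      rw [act_cons, states, if_neg (by simp [hc]), List.countP_cons_of_neg (by simp [hc])]
      exact (DerLE_elem_zero hc h0 m).trans (ih hx m)
    cases c
    · exact hzero rfl ((act_apply_zero x v).trans hx.1) hx.2
    · exact hone rfl hx
    · exact hzero rfl ((act_apply_zero x v).trans hx.1) hx.2
    · exact hone rfl hx

theorem Der_act {x : List Gen} {v : InfWord} (hv : Full v) (hx : Admissible (v 0) (v 0) x) :
    Der (act x v) = states x v ∪ Der v := by
  induction x with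
  | nil => simp [states]
  | cons c x ih =>
    have hfull := hv.act x
    have hone : c.isOne → Admissible (v 0) (v 0) x →
        Der (act (c :: x) v) = states (c :: x) v ∪ Der v := fun hc hx => by
      rw [act_cons, states, if_pos hc, Der_elem_one hc hfull, ih hx, Set.insert_union]
    have hzero : c.isOne = false → act x v 0 = c.moved → Admissible (v 0) (v 0) x →
        Der (act (c :: x) v) = states (c :: x) v ∪ Der v := fun hc h0 hx => by
      rw [act_cons, states, if_neg (by simp [hc]), Der_elem_zero hc h0, ih hx]
    cases c
    · exact hzero rfl ((act_apply_zero x v).trans hx.1) hx.2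
    · exact hone rfl hx
    · exact hzero rfl ((act_apply_zero x v).trans hx.1) hx.2
    · exact hone rfl hx

/-- A word fixed by `φ_x`, with `x` admissible, has only the derivated words seen along `x`. -/
theorem Der_eq_states {x : List Gen} {v : InfWord} (hv : Full v)
    (hx : Admissible (v 0) (v 0) x) (h1 : 0 < x.countP Gen.isOne) (hfix : act x v = v) :
    Der v = states x v := by
  apply Set.Subset.antisymm
  · intro q hq
    obtain ⟨m, hm⟩ := (mem_Der_iff _ _).1 hq
    induction m using Nat.strong_induction_on with
    | _ m ih =>
      rcases Nat.eq_zero_or_pos m with rfl | hpos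
      · rw [DerLE_zero] at hm; exact hm.elim
      · have := DerLE_act hv hx m
        rw [hfix] at this
        rcases this hm with h | h
        · exact h
        · exact ih _ (by omega) h
  · have := Der_act hv hx
    rw [hfix] at this
    intro q hq
    rw [this]
    exact Or.inl hq

/-! ### The exchange of letters -/

/-- The morphism that exchanges the two letters. -/
def exch : Morph := morph (of 1) (of 0)

/-- The exchange `a ↔ α`, `b ↔ β`. -/
def Gen.exch : Gen → Gen
  | .a => .α
  | .b => .β
  | .α => .a
  | .β => .b

@[simp] theorem exch_of (c : Fin 2) : exch (of c) = of (1 - c) := by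
  fin_cases c <;> rfl

theorem exch_mul_exch : exch * exch = 1 := by
  apply FreeMonoid.hom_eq
  intro c
  change exch (exch (of c)) = of c
  rw [exch_of, exch_of]
  fin_cases c <;> rfl

theorem nonErasing_exch : NonErasing exch := fun c => by rw [exch_of]; exact of_ne_one _

theorem injective_exch : Function.Injective exch :=
  Function.LeftInverse.injective (g := exch) fun x => by
    change (exch * exch) x = x
    rw [exch_mul_exch]
    rfl

theorem elem_exch (g : Gen) : elem g.exch = exch * elem g * exch := by
  apply FreeMonoid.hom_eq
  intro c
  fin_cases c <;> cases g <;> rfl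

theorem phi_map_exch (x : List Gen) : phi (x.map Gen.exch) = exch * phi x * exch := by
  induction x with
  | nil => simp [exch_mul_exch]
  | cons c x ih =>
    rw [List.map_cons, phi_cons, ih, elem_exch, phi_cons]
    simp only [mul_assoc]
    rw [← mul_assoc exch exch, exch_mul_exch, one_mul]

theorem cut_exch (v : InfWord) (n : ℕ) : cut exch v n = n := by
  induction n with
  | zero => simp
  | succ n ih => rw [cut_succ, ih, exch_of, length_of]

theorem image_exch_apply (v : InfWord) (n : ℕ) : image exch v n = 1 - v n := by
  have := (isImage_image nonErasing_exch v).map_of n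
  rw [exch_of, length_of, factor_one, cut_exch] at this
  exact (of_injective this).symm

theorem Der_image_exch (v : InfWord) : Der (image exch v) = Der v := by
  have h := isImage_image nonErasing_exch v
  have hocc : ∀ n, OccMatch exch v (image exch v) n n := fun n j => by
    have hinj : ∀ c d : Fin 2, 1 - c = 1 - d ↔ c = d := by decide
    simp only [cut_exch, isOcc_pref_iff, image_exch_apply, hinj, exists_eq_left']
  have hiff := fun n d => isDerivated_iff nonErasing_exch injective_exch h (hocc n) d
  ext q
  constructor <;> rintro ⟨m, d, h1, h2, h3⟩
  · exact ⟨m, d, h1, (hiff m d).1 h2, h3⟩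
  · exact ⟨m, d, h1, (hiff m d).2 h2, h3⟩

theorem Full.image_exch {v : InfWord} (hv : Full v) : Full (image exch v) := fun c => by
  obtain ⟨i, hi⟩ := hv (1 - c)
  refine ⟨i, ?_⟩
  rw [image_exch_apply, hi]
  exact (by decide : ∀ c : Fin 2, 1 - (1 - c) = c) c

theorem act_map_exch (x : List Gen) (v : InfWord) :
    act (x.map Gen.exch) (image exch v) = image exch (act x v) := by
  have hn := nonErasing_exch
  have hx := nonErasing_phi x
  rw [act, phi_map_exch, image_mul (hn.mul hx) hn, image_mul hn hx, ← image_mul hn hn,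
    exch_mul_exch, image_one]
  rfl

theorem isOne_exch (c : Gen) : c.exch.isOne = c.isOne := by cases c <;> rfl

theorem isLatin_exch (c : Gen) : c.exch.isLatin = !c.isLatin := by cases c <;> rfl

theorem countP_map_exch (x : List Gen) :
    (x.map Gen.exch).countP Gen.isOne = x.countP Gen.isOne := by
  rw [List.countP_map]
  congr 1
  funext c
  exact isOne_exch c

theorem first_map_exch (x : List Gen) (l : Fin 2) :
    first (x.map Gen.exch) (1 - l) = 1 - first x l := by
  induction x with
  | nil => rfl
  | cons c x ih => cases c <;> simp [first, Gen.exch, ih]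

theorem admissible_map_exch (p q : Fin 2) (x : List Gen) :
    Admissible (1 - q) (1 - p) (x.map Gen.exch) ↔ Admissible p q x := by
  have e1 : ∀ c : Fin 2, 1 - c = 1 ↔ c = 0 := by decide
  have e0 : ∀ c : Fin 2, 1 - c = 0 ↔ c = 1 := by decide
  induction x with
  | nil => simp [Admissible]
  | cons c x ih => cases c <;> simp [Admissible, Gen.exch, ih, first_map_exch, e1, e0]

/-! ### Rewriting to normal form -/

theorem elem_α_pow (k : ℕ) : (elem .α ^ k) (of 0) = of 0 * of 1 ^ k ∧
    (elem .α ^ k) (of 1) = of 1 := by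
  induction k with
  | zero => simp
  | succ k ih =>
    have h0 : elem .α (of 0) = of 0 * of 1 := rfl
    have h1 : elem .α (of 1) = of 1 := rfl
    simp only [pow_succ', Monoid.End.coe_mul, Function.comp_apply, ih, map_mul, map_pow, h0, h1,
      and_true]
    rw [mul_assoc]

theorem elem_β_pow (k : ℕ) : (elem .β ^ k) (of 0) = of 1 ^ k * of 0 ∧
    (elem .β ^ k) (of 1) = of 1 := by
  induction k with
  | zero => simp
  | succ k ih =>
    have h0 : elem .β (of 0) = of 1 * of 0 := rfl
    have h1 : elem .β (of 1) = of 1 := rfl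
    simp only [pow_succ', Monoid.End.coe_mul, Function.comp_apply, ih, map_mul, map_pow, h0, h1,
      and_true]
    rw [← mul_assoc, ← pow_succ, pow_succ']

theorem phi_replicate (k : ℕ) (g : Gen) : phi (List.replicate k g) = elem g ^ k := by
  simp [phi]

/-- The relation `a α^k b = b β^k a` between elementary morphisms. -/
theorem phi_latin (k : ℕ) : phi (.a :: List.replicate k .α ++ [.b]) =
    phi (.b :: List.replicate k .β ++ [.a]) := by
  have a0 : elem .a (of 0) = of 0 := rfl
  have a1 : elem .a (of 1) = of 1 * of 0 := rfl
  have b0 : elem .b (of 0) = of 0 := rfl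
  have b1 : elem .b (of 1) = of 0 * of 1 := rfl
  have hs : SemiconjBy (of 0 : Word) (of 1 * of 0) (of 0 * of 1) := (mul_assoc _ _ _).symm
  have h1 : (of 0 : Word) * (of 1 * of 0) ^ k = (of 0 * of 1) ^ k * of 0 := hs.pow_right k
  have h2 : (of 0 : Word) * (of 1 * of 0) ^ (k + 1) = (of 0 * of 1) ^ (k + 1) * of 0 :=
    hs.pow_right (k + 1)
  simp only [phi_append, phi_cons, phi_replicate, phi_nil, mul_one]
  apply FreeMonoid.hom_eq
  intro c
  change elem .a ((elem .α ^ k) (elem .b (of c))) = elem .b ((elem .β ^ k) (elem .a (of c)))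
  fin_cases c
  · change elem .a ((elem .α ^ k) (elem .b (of 0))) = elem .b ((elem .β ^ k) (elem .a (of 0)))
    simp only [b0, a0, (elem_α_pow k).1, (elem_β_pow k).1, map_mul, map_pow, a1, b1, h1]
  · change elem .a ((elem .α ^ k) (elem .b (of 1))) = elem .b ((elem .β ^ k) (elem .a (of 1)))
    simp only [b0, a0, b1, a1, (elem_α_pow k), (elem_β_pow k), map_mul, map_pow]
    rw [mul_assoc, ← pow_succ, h2, pow_succ', mul_assoc]

theorem phi_greek (k : ℕ) : phi (.α :: List.replicate k .a ++ [.β]) =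
    phi (.β :: List.replicate k .b ++ [.α]) := by
  have h := congrArg (fun ψ => exch * ψ * exch) (phi_latin k)
  simpa only [← phi_map_exch, List.map_append, List.map_cons, List.map_replicate, List.map_nil,
    Gen.exch] using h

theorem Step.phi_eq {x y : List Gen} (h : Step x y) : phi x = phi y := by
  cases h with
  | greek x y k => simp only [phi_append x, phi_append _ y, phi_greek, List.append_assoc x]
  | latin x y k => simp only [phi_append x, phi_append _ y, phi_latin, List.append_assoc x]

theorem Step.map_isLatin {x y : List Gen} (h : Step x y) :
    x.map Gen.isLatin = y.map Gen.isLatin := by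
  cases h <;> simp [Gen.isLatin]

theorem Step.countP_pos {x y : List Gen} (h : Step x y) : 0 < y.countP Gen.isOne := by
  rw [List.countP_pos_iff]
  cases h with
  | greek x y k => exact ⟨.β, by simp, rfl⟩
  | latin x y k => exact ⟨.b, by simp, rfl⟩

/-- A name read as a binary number, most significant digit first, with digit `1` for the letters
`b` and `β`. -/
def binary : List Gen → ℕ
  | [] => 0
  | c :: x => (if c.isOne then 2 ^ x.length else 0) + binary x

theorem binary_lt (x : List Gen) : binary x < 2 ^ x.length := by
  induction x with
  | nil => simp [binary]
  | cons c x ih =>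
    rw [binary, List.length_cons, pow_succ]
    split_ifs <;> omega

theorem binary_append (x y : List Gen) : binary (x ++ y) = binary x * 2 ^ y.length + binary y := by
  induction x with
  | nil => simp [binary]
  | cons c x ih =>
    rw [List.cons_append, binary, binary, ih, List.length_append, pow_add]
    split_ifs <;> ring

theorem binary_lt_append (x : List Gen) {c d : Gen} (hc : c.isOne = false) (hd : d.isOne = true)
    {y z : List Gen} (hyz : y.length = z.length) : binary (x ++ c :: y) < binary (x ++ d :: z) := by
  have := binary_lt y
  rw [hyz] at this
  rw [binary_append, binary_append, binary, binary, hc, hd, List.length_cons, List.length_cons, hyz]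
  simp
  omega

theorem Step.binary_lt {x y : List Gen} (h : Step x y) : binary x < binary y := by
  cases h with
  | greek x y k =>
    simp only [List.append_assoc, List.cons_append]
    exact binary_lt_append x rfl rfl (by simp)
  | latin x y k =>
    simp only [List.append_assoc, List.cons_append]
    exact binary_lt_append x rfl rfl (by simp)

theorem Step.length_eq {x y : List Gen} (h : Step x y) : x.length = y.length := by
  simpa using congrArg List.length h.map_isLatin

theorem lex_append_left {x y : List Gen} (z : List Gen) (h : List.Lex GenLt x y) :
    List.Lex GenLt (z ++ x) (z ++ y) := by
  induction z with
  | nil => exact h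
  | cons c z ih => exact List.Lex.cons ih

theorem Step.lex {x y : List Gen} (h : Step x y) : List.Lex GenLt x y := by
  cases h with
  | greek x y k =>
    simp only [List.append_assoc, List.cons_append]
    exact lex_append_left x (List.Lex.rel GenLt.greek)
  | latin x y k =>
    simp only [List.append_assoc, List.cons_append]
    exact lex_append_left x (List.Lex.rel GenLt.latin)

theorem lex_irrefl (x : List Gen) : ¬ List.Lex GenLt x x := by
  induction x with
  | nil => intro h; cases h
  | cons c x ih =>
    intro h
    cases h with
    | rel h => cases h
    | cons h => exact ih h

theorem lex_asymm (x y : List Gen) (h : List.Lex GenLt x y) : ¬ List.Lex GenLt y x := by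
  induction h with
  | nil => intro h; cases h
  | rel h =>
    intro h'
    cases h with
    | latin => cases h' with | rel h' => cases h'
    | greek => cases h' with | rel h' => cases h'
  | cons _ ih =>
    intro h'
    cases h' with
    | rel h' => cases h'
    | cons h' => exact ih h'

theorem exists_replicate_b {x : List Gen} (hx : Admissible 1 0 x) (h : first x 1 = 0) :
    ∃ k y, x = List.replicate k .α ++ .b :: y := by
  induction x with
  | nil => simp [first] at h
  | cons c x ih =>
    cases c with
    | a => simp only [first] at h; rw [hx.1] at h; simp at h
    | b => exact ⟨0, x, rfl⟩
    | α =>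
      obtain ⟨k, y, rfl⟩ := ih hx.2 h
      exact ⟨k + 1, y, by simp [List.replicate_succ]⟩
    | β => simp [first] at h

theorem exists_replicate_β {x : List Gen} (hx : Admissible 1 0 x) (h : first x 0 = 1) :
    ∃ k y, x = List.replicate k .a ++ .β :: y := by
  induction x with
  | nil => simp [first] at h
  | cons c x ih =>
    cases c with
    | α => simp only [first] at h; rw [hx.1] at h; simp at h
    | β => exact ⟨0, x, rfl⟩
    | a =>
      obtain ⟨k, y, rfl⟩ := ih hx.2 h
      exact ⟨k + 1, y, by simp [List.replicate_succ]⟩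
    | b => simp [first] at h

theorem Step.cons (c : Gen) {x y : List Gen} (h : Step x y) : Step (c :: x) (c :: y) := by
  cases h with
  | greek x y k => exact Step.greek (c :: x) y k
  | latin x y k => exact Step.latin (c :: x) y k

/-- A name to which no rewriting rule applies from left to right is admissible. -/
theorem exists_step {x : List Gen} (hx : ¬ Admissible 1 0 x) : ∃ y, Step x y := by
  induction x with
  | nil => exact absurd trivial hx
  | cons c x ih =>
    by_cases h : Admissible 1 0 x
    · have e1 : ∀ d : Fin 2, d ≠ 1 → d = 0 := by decide
      have e0 : ∀ d : Fin 2, d ≠ 0 → d = 1 := by decide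
      cases c with
      | a =>
        obtain ⟨k, y, rfl⟩ := exists_replicate_b h (e1 _ fun h1 => hx ⟨h1, h⟩)
        exact ⟨_, by simpa using Step.latin [] y k⟩
      | b => exact absurd h hx
      | α =>
        obtain ⟨k, y, rfl⟩ := exists_replicate_β h (e0 _ fun h1 => hx ⟨h1, h⟩)
        exact ⟨_, by simpa using Step.greek [] y k⟩
      | β => exact absurd h hx
    · obtain ⟨y, hy⟩ := ih h
      exact ⟨_, hy.cons c⟩

theorem IsNormalizedName.admissible {ψ : Morph} {w : List Gen} (h : IsNormalizedName ψ w) :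
    Admissible 1 0 w := by
  by_contra hw
  obtain ⟨v, hv⟩ := exists_step hw
  obtain ⟨x, -, hx, hmax⟩ := h
  rcases hmax v (hx.trans _ _ _ (Relation.EqvGen.rel _ _ hv)) with rfl | hlex
  · exact lex_irrefl _ hv.lex
  · exact lex_asymm _ _ hv.lex hlex

theorem exists_admissible (x : List Gen) : ∃ y, Admissible 1 0 y ∧ phi y = phi x ∧
    y.map Gen.isLatin = x.map Gen.isLatin ∧
    (0 < x.countP Gen.isOne → 0 < y.countP Gen.isOne) := by
  induction hn : 2 ^ x.length - binary x using Nat.strong_induction_on generalizing x with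
  | _ n ih =>
    by_cases hx : Admissible 1 0 x
    · exact ⟨x, hx, rfl, rfl, id⟩
    · obtain ⟨y, hy⟩ := exists_step hx
      have h1 := hy.binary_lt
      have h2 := binary_lt y
      rw [← hy.length_eq] at h2
      obtain ⟨z, hz1, hz2, hz3, hz4⟩ := ih _ (by rw [← hy.length_eq]; omega) y rfl
      exact ⟨z, hz1, hz2.trans hy.phi_eq.symm, hz3.trans hy.map_isLatin.symm,
        fun _ => hz4 hy.countP_pos⟩

/-! ### Carrying a digit -/

/-- The map `α ↦ β` that fixes the other letters. -/
def Gen.up : Gen → Gen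
  | .α => .β
  | c => c

theorem phi_carry_aux (x : List Gen) (hx : .β ∉ x) (k : ℕ) :
    phi (.a :: List.replicate k .α ++ x ++ [.b]) =
      phi (.b :: List.replicate k .β ++ x.map Gen.up ++ [.a]) := by
  induction x generalizing k with
  | nil => simpa using phi_latin k
  | cons c x ih =>
    have hx' : .β ∉ x := fun h => hx (List.mem_cons_of_mem _ h)
    have h0 := ih hx' 0
    have hk := phi_latin k
    simp only [List.replicate_zero, List.cons_append, List.nil_append] at h0
    cases c with
    | a =>
      calc phi (.a :: List.replicate k .α ++ .a :: x ++ [.b])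
          = phi (.a :: List.replicate k .α) * phi (.a :: (x ++ [.b])) := by
            rw [← phi_append]; simp
        _ = phi (.a :: List.replicate k .α ++ [.b]) * phi (x.map Gen.up ++ [.a]) := by
            rw [h0, ← phi_append, ← phi_append]; simp
        _ = _ := by rw [hk, ← phi_append]; simp [Gen.up]
    | b =>
      calc phi (.a :: List.replicate k .α ++ .b :: x ++ [.b])
          = phi (.a :: List.replicate k .α ++ [.b]) * phi (x ++ [.b]) := by
            rw [← phi_append]; simp
        _ = phi (.b :: List.replicate k .β) * phi (.a :: (x ++ [.b])) := by
            rw [hk, ← phi_append, ← phi_append]; simp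
        _ = _ := by rw [h0, ← phi_append]; simp [Gen.up]
    | α =>
      have h1 := ih hx' (k + 1)
      simp only [List.replicate_succ', List.cons_append, List.append_assoc, List.nil_append,
        List.map_cons, Gen.up] at h1 ⊢
      exact h1
    | β => exact absurd List.mem_cons_self hx

/-- A letter `a` and a later letter `b` may be exchanged if no `β` stands between them, provided
that the letters `α` between them become `β`. -/
theorem phi_carry {x : List Gen} (hx : .β ∉ x) :
    phi (.a :: x ++ [.b]) = phi (.b :: x.map Gen.up ++ [.a]) := by
  simpa using phi_carry_aux x hx 0

/-! ### The directive word of a fixed point -/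

theorem admissible_up_of_zeros {t : List Gen} (ht : ∀ c ∈ t, c = .a ∨ c = .α) (q : Fin 2) :
    Admissible 1 q (t.map Gen.up) ∧ first (t.map Gen.up) 1 = 1 := by
  induction t with
  | nil => simp [Admissible, first]
  | cons c t ih =>
    obtain ⟨h1, h2⟩ := ih fun d hd => ht d (List.mem_cons_of_mem _ hd)
    rcases ht c List.mem_cons_self with rfl | rfl <;> simp [Gen.up, Admissible, first, h1, h2]

/-- Carrying turns the tail `t` into a word over `a`, `β`, which is admissible in front of a word
starting with `1`, or if its last letter is `β`. -/
theorem admissible_up_tail {t : List Gen} (ht : ∀ c ∈ t, c = .a ∨ c = .α) {p : Fin 2}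
    (h : p = 1 ∨ ∃ t', t = t' ++ [.α]) :
    Admissible p p (t.map Gen.up) ∧ first (t.map Gen.up) p = 1 := by
  rcases h with rfl | ⟨t', rfl⟩
  · exact admissible_up_of_zeros ht 1
  · obtain ⟨h1, h2⟩ := admissible_up_of_zeros (t := t')
      (fun c hc => ht c (List.mem_append_left _ hc)) 1
    simp [admissible_append, first_append, Gen.up, first, Admissible, h1, h2]

theorem admissible_head {h : List Gen} (hh : ∀ c ∈ h, c = .α ∨ c = .b) (p : Fin 2) :
    Admissible p 0 h ∧ first h 0 = 0 := by
  induction h with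
  | nil => simp [Admissible, first]
  | cons c h ih =>
    obtain ⟨h1, h2⟩ := ih fun d hd => hh d (List.mem_cons_of_mem _ hd)
    rcases hh c List.mem_cons_self with rfl | rfl <;> simp [Admissible, first, h1, h2]

theorem admissible_up_head {h : List Gen} (hh : ∀ c ∈ h, c = .α ∨ c = .b) (p q : Fin 2) :
    Admissible p q (h.map Gen.up) := by
  induction h with
  | nil => simp [Admissible]
  | cons c h ih =>
    have h1 := ih fun d hd => hh d (List.mem_cons_of_mem _ hd)
    rcases hh c List.mem_cons_self with rfl | rfl <;> simp [Gen.up, Admissible, h1]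

theorem countP_lt_of_mem {x : List Gen} {c : Gen} (hc : c ∈ x) (h : c.isOne = false) :
    x.countP Gen.isOne + 1 ≤ x.length := by
  have h1 : x.countP Gen.isOne ≤ x.length := List.countP_le_length
  rcases h1.lt_or_eq with h1 | h1
  · exact h1
  · have := List.countP_eq_length.1 h1 c hc
    rw [h] at this
    simp at this

/-- `Der(u)` is finite, nonempty and has at most `N` elements. -/
def DerBound (N : ℕ) (u : InfWord) : Prop :=
  (Der u).Finite ∧ (Der u).Nonempty ∧ (Der u).ncard ≤ N

/-- If `u = φ_{d₀}(v)` and `v = φ_{d₁}(v)`, then the derivated words of `u` are those seen along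
`d₀ d₁`. The word `v` is seen both at the end of `d₀` and at the end of `d₁`, which saves one
element if both end in `b` or `β`. -/
theorem derBound_of_directive {d₀ d₁ : List Gen} {u v : InfWord} (hv : Full v) (h0 : act d₀ v = u)
    (h1 : act d₁ v = v) (ha0 : Admissible (v 0) (v 0) d₀) (ha1 : Admissible (v 0) (v 0) d₁)
    (hlen : d₁.length = d₀.length) (hone : 0 < d₁.countP Gen.isOne) {c : Gen} (hc : c ∈ d₁)
    (hc0 : c.isOne = false)
    (hsave : (∃ c ∈ d₀, c.isOne = false) ∨ ∃ e₀ e₁ : List Gen, d₀ = e₀ ++ [.β] ∧ d₁ = e₁ ++ [.β]) :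
    DerBound (2 * d₀.length - 2) u := by
  have hder : Der u = states d₀ v ∪ states d₁ v := by
    rw [← h0, Der_act hv ha0, Der_eq_states hv ha1 hone h1]
  have hc1 := countP_lt_of_mem hc hc0
  have hs1 := states_ncard_le d₁ v
  refine ⟨?_, ?_, ?_⟩
  · rw [hder]
    exact (states_finite _ _).union (states_finite _ _)
  · rw [hder]
    exact (states_nonempty hone v).mono Set.subset_union_right
  · rw [hder]
    rcases hsave with ⟨e, he, he0⟩ | ⟨e₀, e₁, rfl, rfl⟩
    · have hc2 := countP_lt_of_mem he he0
      have hs2 := states_ncard_le d₀ v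
      have := Set.ncard_union_le (states d₀ v) (states d₁ v)
      omega
    · have heq : states (e₀ ++ [.β]) v ∪ states (e₁ ++ [.β]) v =
          states e₀ (act [.β] v) ∪ states (e₁ ++ [.β]) v := by
        rw [states_append, states_append, Set.union_assoc, ← Set.union_assoc (states [_] v),
          Set.union_comm (states [_] v), Set.union_assoc (states e₁ _), Set.union_self]
      rw [heq]
      have hs2 := states_ncard_le e₀ (act [.β] v)
      have hs3 : e₀.countP Gen.isOne ≤ e₀.length := List.countP_le_length
      have := Set.ncard_union_le (states e₀ (act [.β] v)) (states (e₁ ++ [.β]) v)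
      simp only [List.length_append, List.length_singleton] at *
      omega

/-- The fixed point of `φ_w` for `w = h b m a t`, where `a t` is the part at the end of `w` that
is not admissible in front of another copy of `w`. Carrying the digit of `b` in each copy of `w`
into the preceding copy gives the directive word `d₀ d₁ d₁ d₁ ⋯` of `u`. -/
theorem derBound_of_carry {h m t : List Gen} {u : InfWord} (hu : Full u)
    (hfix : act (h ++ .b :: (m ++ .a :: t)) u = u) (hh : ∀ c ∈ h, c = .α ∨ c = .b)
    (ht : ∀ c ∈ t, c = .a ∨ c = .α) (hm : Admissible 0 0 m)
    (hm' : (∃ e, m = List.replicate e .α) ∨ first m 0 = 1)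
    (hcase : (∃ h', h = .α :: h') ∨ ∃ t', t = t' ++ [.α]) :
    DerBound (2 * (h ++ .b :: (m ++ .a :: t)).length - 2) u := by
  have hth : .β ∉ t ++ h := by
    intro hb
    rcases List.mem_append.1 hb with hb | hb
    · rcases ht _ hb with hb | hb <;> cases hb
    · rcases hh _ hb with hb | hb <;> cases hb
  set w := h ++ .b :: (m ++ .a :: t) with hw
  set d₀ := h ++ .b :: (m ++ .b :: t.map Gen.up) with hd₀
  set e := h.map Gen.up ++ .a :: (m ++ .b :: t.map Gen.up) with he
  set w' := h.map Gen.up ++ .a :: (m ++ .a :: t) with hw'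
  have hcarry := phi_carry hth
  have hphi0 : phi (w ++ w) = phi (d₀ ++ w') := by
    calc phi (w ++ w)
        = phi (h ++ .b :: m) * phi (.a :: (t ++ h) ++ [.b]) * phi (m ++ .a :: t) := by
          rw [← phi_append, ← phi_append, hw]; simp
      _ = _ := by rw [hcarry, ← phi_append, ← phi_append, hd₀, hw']; simp
  have hphi1 : phi (w' ++ w) = phi (e ++ w') := by
    calc phi (w' ++ w)
        = phi (h.map Gen.up ++ .a :: m) * phi (.a :: (t ++ h) ++ [.b]) * phi (m ++ .a :: t) := by
          rw [← phi_append, ← phi_append, hw, hw']; simp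
      _ = _ := by rw [hcarry, ← phi_append, ← phi_append, he, hw']; simp
  set v := act w' u with hv
  have hvfull : Full v := hu.act w'
  have hact0 : act d₀ v = u := by
    rw [hv, ← act_append, ← act_congr hphi0, act_append, hfix, hfix]
  have hacte : act e v = v := by
    rw [hv, ← act_append, ← act_congr hphi1, act_append, hfix]
  have hlen : d₀.length = w.length := by rw [hd₀, hw]; simp
  have hv0 : v 0 = 1 ∨ ∃ t', t = t' ++ [.α] := by
    refine hcase.imp_left ?_
    rintro ⟨h', rfl⟩
    rw [hv, act_apply_zero, hw']
    simp [Gen.up, first]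
  obtain ⟨htad, htf⟩ := admissible_up_tail ht hv0
  have ha0 : Admissible (v 0) (v 0) d₀ := by
    rw [hd₀, admissible_append]
    refine ⟨(admissible_head hh _).1, ?_⟩
    change Admissible _ _ (m ++ _)
    rw [admissible_append]
    exact ⟨hm, htad⟩
  have hz0 : ∀ d₁ : List Gen, (∀ t', t = t' ++ [.α] → ∃ e₁, d₁ = e₁ ++ [.β]) →
      (∃ c ∈ d₀, c.isOne = false) ∨ ∃ e₀ e₁ : List Gen, d₀ = e₀ ++ [.β] ∧ d₁ = e₁ ++ [.β] := by
    intro d₁ hd₁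
    rcases hcase with ⟨h', rfl⟩ | ⟨t', ht'⟩
    · exact Or.inl ⟨.α, by simp [hd₀], rfl⟩
    · obtain ⟨e₁, he₁⟩ := hd₁ t' ht'
      refine Or.inr ⟨h ++ .b :: (m ++ .b :: t'.map Gen.up), e₁, ?_, he₁⟩
      rw [hd₀, ht']
      simp [Gen.up]
  rw [← hlen]
  rcases hm' with ⟨k, hk⟩ | hm1
  · set d₁ := h.map Gen.up ++ .b :: (List.replicate k .β ++ .a :: t.map Gen.up) with hd₁
    have hphi2 : phi e = phi d₁ := by
      calc phi e = phi (h.map Gen.up) * phi (.a :: List.replicate k .α ++ [.b]) *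
            phi (t.map Gen.up) := by rw [← phi_append, ← phi_append, he, hk]; simp
        _ = _ := by rw [phi_latin, ← phi_append, ← phi_append, hd₁]; simp
    have hβ : ∀ (p q : Fin 2) (k : ℕ), Admissible p q (List.replicate k .β) := fun p q k => by
      induction k with
      | zero => simp [Admissible]
      | succ k ih => simpa [List.replicate_succ, Admissible] using ih
    refine derBound_of_directive (d₁ := d₁) (c := .a) hvfull hact0 ?_ ha0 ?_ ?_ ?_ ?_ rfl
      (hz0 d₁ ?_)
    · rw [← act_congr hphi2, hacte]
    · rw [hd₁, admissible_append]
      refine ⟨admissible_up_head hh _ _, ?_⟩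
      change Admissible _ _ (List.replicate k .β ++ _)
      rw [admissible_append]
      exact ⟨hβ _ _ _, htf, htad⟩
    · rw [hd₁, hd₀, hk]; simp
    · rw [hd₁, List.countP_pos_iff]; exact ⟨.b, by simp, rfl⟩
    · rw [hd₁]; simp
    · rintro t' ht'
      exact ⟨h.map Gen.up ++ .b :: (List.replicate k .β ++ .a :: t'.map Gen.up), by
        rw [hd₁, ht']; simp [Gen.up]⟩
  · refine derBound_of_directive (d₁ := e) (c := .a) hvfull hact0 hacte ha0 ?_ ?_ ?_ ?_ rfl
      (hz0 e ?_)
    · rw [he, admissible_append]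
      refine ⟨admissible_up_head hh _ _, ?_, ?_⟩
      · rw [first_append]; exact hm1
      · rw [admissible_append]
        exact ⟨hm, htad⟩
    · rw [he, hd₀]; simp
    · rw [he, List.countP_pos_iff]; exact ⟨.b, by simp, rfl⟩
    · rw [he]; simp
    · rintro t' ht'
      exact ⟨h.map Gen.up ++ .a :: (m ++ .b :: t'.map Gen.up), by
        rw [he, ht']; simp [Gen.up]⟩

/-! ### Factorization of a name -/

theorem exists_last_one {w : List Gen} (h : 0 < w.countP Gen.isOne) :
    ∃ y c s, w = y ++ c :: s ∧ c.isOne ∧ ∀ d ∈ s, d = .a ∨ d = .α := by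
  induction w with
  | nil => simp at h
  | cons d w ih =>
    rcases Nat.eq_zero_or_pos (w.countP Gen.isOne) with h0 | hpos
    · refine ⟨[], d, w, rfl, ?_, fun c hc => ?_⟩
      · by_contra hd
        rw [List.countP_cons_of_neg hd] at h
        omega
      · have := List.countP_eq_zero.1 h0 c hc
        cases c <;> simp [Gen.isOne] at this ⊢
    · obtain ⟨y, c, s, rfl, h1, h2⟩ := ih hpos
      exact ⟨d :: y, c, s, rfl, h1, h2⟩

theorem exists_first_a {s : List Gen} (h : ∀ d ∈ s, d = .a ∨ d = .α) :
    (∃ e, s = List.replicate e .α) ∨ ∃ e t, s = List.replicate e .α ++ .a :: t := by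
  induction s with
  | nil => exact Or.inl ⟨0, rfl⟩
  | cons c s ih =>
    rcases h c List.mem_cons_self with rfl | rfl
    · exact Or.inr ⟨0, s, rfl⟩
    · rcases ih fun d hd => h d (List.mem_cons_of_mem _ hd) with ⟨e, rfl⟩ | ⟨e, t, rfl⟩
      · exact Or.inl ⟨e + 1, rfl⟩
      · exact Or.inr ⟨e + 1, t, rfl⟩

theorem admissible_replicate_α (p : Fin 2) (e : ℕ) : Admissible p 0 (List.replicate e .α) :=
  (admissible_head (fun _ hc => Or.inl (List.eq_of_mem_replicate hc)) p).1

theorem first_replicate_α (l : Fin 2) (e : ℕ) : first (List.replicate e .α) l = l := by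
  induction e with
  | zero => rfl
  | succ e ih => simpa [List.replicate_succ, first] using ih

/-- Split after the last `b` that is preceded by letters `α` and `b` only. -/
theorem exists_head {y : List Gen} (hy : Admissible 0 0 y) :
    ∃ h m, .b :: y = h ++ .b :: m ∧ (∀ c ∈ h, c = .α ∨ c = .b) ∧
      ((∃ e, m = List.replicate e .α) ∨ first m 0 = 1) := by
  induction y with
  | nil => exact ⟨[], [], rfl, by simp, Or.inl ⟨0, rfl⟩⟩
  | cons c y ih =>
    cases c with
    | a => exact ⟨[], .a :: y, rfl, by simp, Or.inr hy.1⟩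
    | β => exact ⟨[], .β :: y, rfl, by simp, Or.inr rfl⟩
    | b =>
      obtain ⟨h, m, h1, h2, h3⟩ := ih hy
      refine ⟨.b :: h, m, by rw [h1]; rfl, fun d hd => ?_, h3⟩
      rcases List.mem_cons.1 hd with rfl | hd
      · exact Or.inr rfl
      · exact h2 d hd
    | α =>
      obtain ⟨h, m, h1, h2, h3⟩ := ih hy.2
      cases h with
      | nil =>
        obtain rfl : y = m := by simpa using h1
        refine ⟨[], .α :: y, rfl, by simp, ?_⟩
        rcases h3 with ⟨e, rfl⟩ | h3
        · exact Or.inl ⟨e + 1, rfl⟩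
        · exact Or.inr h3
      | cons d h =>
        obtain ⟨rfl, rfl⟩ : d = .b ∧ y = h ++ .b :: m := by
          have := List.cons.inj h1
          exact ⟨this.1.symm, this.2⟩
        refine ⟨.b :: .α :: h, m, rfl, fun d hd => ?_, h3⟩
        rcases List.mem_cons.1 hd with rfl | hd
        · exact Or.inr rfl
        · rcases List.mem_cons.1 hd with rfl | hd
          · exact Or.inl rfl
          · exact h2 d (List.mem_cons_of_mem _ hd)

/-- The factorization of a normalized name whose first letter among `b`, `β` is `b`, and for which
`w w w ⋯` is not normalized. -/
theorem exists_carry_factorization {w : List Gen} (hw : Admissible 1 0 w)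
    (hone : 0 < w.countP Gen.isOne) (hf : first w 1 = 0) (hbad : ¬ Admissible 0 0 w) :
    ∃ h m t, w = h ++ .b :: (m ++ .a :: t) ∧ (∀ c ∈ h, c = .α ∨ c = .b) ∧
      (∀ c ∈ t, c = .a ∨ c = .α) ∧ Admissible 0 0 m ∧
      ((∃ e, m = List.replicate e .α) ∨ first m 0 = 1) := by
  obtain ⟨y, c, s, rfl, hc, hs⟩ := exists_last_one hone
  have hfc : ∀ (x : List Gen) (p q : Fin 2), first (c :: x) p = first (c :: x) q := fun x p q => by
    cases c <;> simp [Gen.isOne, first] at hc ⊢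
  have hac : ∀ (x : List Gen) (p q : Fin 2), Admissible p q (c :: x) ↔ Admissible p q x :=
    fun x p q => by cases c <;> simp [Gen.isOne, Admissible] at hc ⊢
  have hfc' : ∀ (x : List Gen) (p : Fin 2), first (c :: x) p = first [c] p := fun x p => by
    cases c <;> simp [Gen.isOne, first] at hc ⊢
  rw [admissible_append, hac] at hw hbad
  rcases exists_first_a hs with ⟨e, rfl⟩ | ⟨e, t, rfl⟩
  · exfalso
    apply hbad
    refine ⟨?_, admissible_replicate_α 0 e⟩
    have := hw.1
    rwa [hfc _ 0 1] at this ⊢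
  · have hy : ∀ p q, Admissible p q (y ++ [c]) := fun p q => by
      rw [admissible_append, hac]
      refine ⟨?_, trivial⟩
      have := hw.1
      rw [hfc' _ 1, hfc' _ 0, hfc [] 1 p, hfc [] 0 q] at this
      exact this
    have hyf : first (y ++ [c]) 1 = 0 := by
      rw [first_append] at hf ⊢
      rwa [hfc' _ 1] at hf
    obtain ⟨k, z, hz⟩ := exists_replicate_b (hy 1 0) hyf
    have hz0 : Admissible 0 0 z := by
      have := hy 0 0
      rw [hz, admissible_append] at this
      exact this.2
    obtain ⟨h, m, h1, h2, h3⟩ := exists_head hz0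
    have hm0 : Admissible 0 0 m := by
      have : Admissible 0 0 (.b :: z) := hz0
      rw [h1, admissible_append] at this
      exact this.2
    refine ⟨List.replicate k .α ++ h, m ++ List.replicate e .α, t, ?_, ?_, ?_, ?_, ?_⟩
    · calc y ++ c :: (List.replicate e .α ++ .a :: t)
          = (y ++ [c]) ++ (List.replicate e .α ++ .a :: t) := by simp
        _ = List.replicate k .α ++ (.b :: z) ++ (List.replicate e .α ++ .a :: t) := by rw [hz]
        _ = _ := by rw [h1]; simp
    · intro d hd
      rcases List.mem_append.1 hd with hd | hd
      · exact Or.inl (List.eq_of_mem_replicate hd)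
      · exact h2 d hd
    · exact fun d hd => hs d (by simp [hd])
    · rw [admissible_append, first_replicate_α]
      exact ⟨hm0, admissible_replicate_α 0 e⟩
    · rcases h3 with ⟨e', rfl⟩ | h3
      · exact Or.inl ⟨e' + e, by rw [List.replicate_add]⟩
      · exact Or.inr (by rw [first_append, first_replicate_α]; exact h3)

/-! ### The upper bound -/

theorem first_eq_of_countP_pos {x : List Gen} (h : 0 < x.countP Gen.isOne) (p q : Fin 2) :
    first x p = first x q := by
  induction x with
  | nil => simp at h
  | cons c x ih =>
    cases c
    · exact ih (by rwa [List.countP_cons_of_neg (by simp [Gen.isOne])] at h)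
    · rfl
    · exact ih (by rwa [List.countP_cons_of_neg (by simp [Gen.isOne])] at h)
    · rfl

theorem derBound_of_fixed_admissible {w : List Gen} {u : InfWord} (hu : Full u)
    (hfix : act w u = u) (hone : 0 < w.countP Gen.isOne) (hw : Admissible (u 0) (u 0) w) :
    DerBound w.length u := by
  have h := Der_eq_states hu hw hone hfix
  refine ⟨?_, ?_, ?_⟩
  · rw [h]; exact states_finite _ _
  · rw [h]; exact states_nonempty hone u
  · rw [h]; exact (states_ncard_le w u).trans List.countP_le_length

/-- The bound of `derBound_of_ends` if the first letter of `w` among `b`, `β` is `b`; the other case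
follows by exchanging the letters. -/
theorem derBound_aux {w : List Gen} {u : InfWord} (hw : Admissible 1 0 w)
    (hone : 0 < w.countP Gen.isOne) (hu : Full u) (hfix : act w u = u) {c d : Gen}
    {z z' : List Gen} (hc : w = c :: z) (hd : w = z' ++ [d]) (hcd : d.isLatin = !c.isLatin)
    (hf : first w 1 = 0) : DerBound (2 * w.length - 2) u := by
  have hlen : 2 ≤ w.length := by
    rcases z with _ | ⟨c', z⟩
    · rw [hc] at hd
      rcases z' with _ | ⟨d', z'⟩
      · have : c = d := by simpa using hd
        rw [this] at hcd
        simp at hcd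
      · simp at hd
    · rw [hc]; simp
  have hu0 : u 0 = 0 := by
    have := act_apply_zero w u
    rw [hfix, first_eq_of_countP_pos hone _ 1, hf] at this
    exact this
  by_cases hbad : Admissible 0 0 w
  · obtain ⟨h1, h2, h3⟩ := derBound_of_fixed_admissible hu hfix hone (by rwa [hu0])
    exact ⟨h1, h2, h3.trans (by omega)⟩
  · obtain ⟨h, m, t, rfl, hh, ht, hm, hm'⟩ := exists_carry_factorization hw hone hf hbad
    refine derBound_of_carry hu hfix hh ht hm hm' ?_
    rcases h with _ | ⟨e, h⟩
    · right
      obtain rfl : c = .b := by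
        have := (List.cons.inj hc).1
        exact this.symm
      rcases List.eq_nil_or_concat t with rfl | ⟨t', e, rfl⟩
      · have h1 : [.b] ++ (m ++ [.a]) = z' ++ [d] := hd
        rw [← List.append_assoc] at h1
        have := (List.append_inj' h1 rfl).2
        obtain rfl : Gen.a = d := by simpa using this
        simp [Gen.isLatin] at hcd
      · have h1 : [] ++ Gen.b :: (m ++ Gen.a :: t'.concat e) = z' ++ [d] := hd
        have h2 : ([.b] ++ m ++ .a :: t') ++ [e] = z' ++ [d] := by simpa using h1
        have := (List.append_inj' h2 rfl).2
        obtain rfl : e = d := by simpa using this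
        refine ⟨t', ?_⟩
        rcases ht e (by simp) with rfl | rfl
        · simp [Gen.isLatin] at hcd
        · simp
    · have hec : e = c := (List.cons.inj hc).1
      rcases hh e List.mem_cons_self with rfl | rfl
      · exact Or.inl ⟨h, rfl⟩
      · right
        subst hec
        rcases List.eq_nil_or_concat t with rfl | ⟨t', e, rfl⟩
        · have h1 : (.b :: h ++ .b :: m) ++ [.a] = z' ++ [d] := by simpa using hd
          have := (List.append_inj' h1 rfl).2
          obtain rfl : Gen.a = d := by simpa using this
          simp [Gen.isLatin] at hcd
        · have h2 : (.b :: h ++ .b :: (m ++ .a :: t')) ++ [e] = z' ++ [d] := by simpa using hd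
          have := (List.append_inj' h2 rfl).2
          obtain rfl : e = d := by simpa using this
          refine ⟨t', ?_⟩
          rcases ht e (by simp) with rfl | rfl
          · simp [Gen.isLatin] at hcd
          · simp

/-- The bound `2 |w| - 2` for a normalized name that starts and ends with letters of different
alphabets `{a, b}`, `{α, β}`. -/
theorem derBound_of_ends {w : List Gen} {u : InfWord} (hw : Admissible 1 0 w)
    (hone : 0 < w.countP Gen.isOne) (hu : Full u) (hfix : act w u = u) {c d : Gen}
    {z z' : List Gen} (hc : w = c :: z) (hd : w = z' ++ [d]) (hcd : d.isLatin = !c.isLatin) :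
    DerBound (2 * w.length - 2) u := by
  rcases (by decide : ∀ x : Fin 2, x = 0 ∨ x = 1) (first w 1) with hf | hf
  · exact derBound_aux hw hone hu hfix hc hd hcd hf
  · have hf' : first (w.map Gen.exch) 1 = 0 := by
      have := first_map_exch w 0
      rw [first_eq_of_countP_pos hone 0 1, hf] at this
      exact this
    have := derBound_aux (w := w.map Gen.exch) (u := image exch u) (c := c.exch) (d := d.exch)
      (z := z.map Gen.exch) (z' := z'.map Gen.exch) ((admissible_map_exch 1 0 w).2 hw)
      (by rwa [countP_map_exch]) hu.image_exch (by rw [act_map_exch, hfix])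
      (by rw [hc]; rfl) (by rw [hd]; simp) (by rw [isLatin_exch, isLatin_exch, hcd]) hf'
    rwa [DerBound, Der_image_exch, List.length_map] at this

/-- Passing from `w = c z` to the normalized name of `z c` loses at most one derivated word. -/
theorem exists_rotation {c : Gen} {z : List Gen} {u : InfWord} (hw : Admissible 1 0 (c :: z))
    (hone : 0 < (c :: z).countP Gen.isOne) (hu : Full u) (hfix : act (c :: z) u = u) :
    ∃ w' u', Admissible 1 0 w' ∧ 0 < w'.countP Gen.isOne ∧ Full u' ∧ act w' u' = u' ∧
      w'.map Gen.isLatin = z.map Gen.isLatin ++ [c.isLatin] ∧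
      ∀ N, DerBound N u' → DerBound (N + 1) u := by
  obtain ⟨w', h1, h2, h3, h4⟩ := exists_admissible (z ++ [c])
  have hu' := hu.act z
  have hu2 : u = image (elem c) (act z u) := by rw [← act_cons, hfix]
  refine ⟨w', act z u, h1, h4 ?_, hu', ?_, by rw [h3]; simp, fun N hN => ?_⟩
  · simpa [List.countP_append, List.countP_cons, Nat.add_comm] using hone
  · rw [act_congr h2, ← act_append, List.append_assoc, act_append]
    exact congrArg _ hfix
  · obtain ⟨hN1, hN2, hN3⟩ := hN
    cases hc : c.isOne
    · have hz : 0 < z.countP Gen.isOne := by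
        rwa [List.countP_cons_of_neg (by simp [hc])] at hone
      have h0 : act z u 0 = c.moved := by
        rw [act_apply_zero]
        cases c
        · rw [first_eq_of_countP_pos hz _ 1, hw.1]; rfl
        · simp [Gen.isOne] at hc
        · rw [first_eq_of_countP_pos hz _ 0, hw.1]; rfl
        · simp [Gen.isOne] at hc
      have := Der_elem_zero hc h0
      rw [← hu2] at this
      rw [DerBound, this]
      exact ⟨hN1, hN2, by omega⟩
    · have := Der_elem_one hc hu'
      rw [← hu2] at this
      rw [DerBound, this]
      exact ⟨hN1.insert _, Set.insert_nonempty _ _, (Set.ncard_insert_le _ _).trans (by omega)⟩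

/-- Rotating the first run of `f` letters of one alphabet to the end of `w` costs at most `f`
derivated words and leads to `derBound_of_ends`. -/
theorem derBound_of_run (L : Bool) (f : ℕ) {w : List Gen} {u : InfWord} (hw : Admissible 1 0 w)
    (hone : 0 < w.countP Gen.isOne) (hu : Full u) (hfix : act w u = u) {r : List Bool}
    (hpat : w.map Gen.isLatin = List.replicate f L ++ (!L) :: (r ++ [L])) :
    DerBound (2 * w.length - 2 + f) u := by
  induction f generalizing w u r with
  | zero =>
    rcases w with _ | ⟨c, z⟩
    · simp at hpat
    rcases List.eq_nil_or_concat (c :: z) with h | ⟨z', d, hd⟩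
    · simp at h
    rw [List.concat_eq_append] at hd
    refine derBound_of_ends hw hone hu hfix rfl hd ?_
    have h1 : c.isLatin = !L := by
      simp only [List.map_cons, List.replicate_zero, List.nil_append] at hpat
      exact (List.cons.inj hpat).1
    have h2 : d.isLatin = L := by
      rw [hd] at hpat
      have h3 : z'.map Gen.isLatin ++ [d.isLatin] = ((!L) :: r) ++ [L] := by simpa using hpat
      simpa using (List.append_inj' h3 rfl).2
    rw [h1, h2]
    simp
  | succ f ih =>
    rcases w with _ | ⟨c, z⟩
    · simp at hpat
    obtain ⟨w', u', h1, h2, h3, h4, h5, h6⟩ := exists_rotation hw hone hu hfix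
    have h7 : c.isLatin = L ∧ z.map Gen.isLatin = List.replicate f L ++ (!L) :: (r ++ [L]) := by
      simp only [List.map_cons, List.replicate_succ, List.cons_append] at hpat
      exact List.cons.inj hpat
    have hlen : w'.length = (c :: z).length := by simpa using congrArg List.length h5
    have := ih h1 h2 h3 h4 (r := r ++ [L]) (by rw [h5, h7.1, h7.2]; simp)
    rw [hlen] at this
    exact h6 _ this

theorem exists_run (L : Bool) (P : List Bool) (h : (!L) ∈ P) :
    ∃ f r, P = List.replicate f L ++ (!L) :: r := by
  induction P with
  | nil => simp at h
  | cons x P ih =>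
    by_cases hx : x = !L
    · exact ⟨0, P, by rw [hx]; rfl⟩
    · obtain rfl : x = L := by simpa using hx
      obtain ⟨f, r, rfl⟩ := ih (by simpa using h)
      exact ⟨f + 1, r, rfl⟩

theorem derBound_of_normalized {w : List Gen} {u : InfWord} (hw : Admissible 1 0 w)
    (hone : 0 < w.countP Gen.isOne) (hu : Full u) (hfix : act w u = u)
    (hlat : ∀ L, L ∈ w.map Gen.isLatin) : 2 ≤ w.length ∧ DerBound (3 * w.length - 4) u := by
  rcases w with _ | ⟨c, z⟩
  · simp at hone
  obtain ⟨f, r, hpat⟩ := exists_run c.isLatin _ (hlat !c.isLatin)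
  rcases List.eq_nil_or_concat (c :: z) with h | ⟨z', d, hd⟩
  · simp at h
  rw [List.concat_eq_append] at hd
  have hlen : (c :: z).length = f + 1 + r.length := by
    have := congrArg List.length hpat
    simp at this ⊢
    omega
  have hf : 0 < f := by
    rcases f with _ | f
    · simp at hpat
    · omega
  refine ⟨by omega, ?_⟩
  by_cases hcd : d.isLatin = !c.isLatin
  · obtain ⟨h1, h2, h3⟩ := derBound_of_ends hw hone hu hfix rfl hd hcd
    exact ⟨h1, h2, h3.trans (by omega)⟩
  · have hcd' : d.isLatin = c.isLatin := by simpa using hcd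
    rcases List.eq_nil_or_concat r with rfl | ⟨r', x, rfl⟩
    · exfalso
      rw [hd] at hpat
      have : z'.map Gen.isLatin ++ [d.isLatin] = List.replicate f c.isLatin ++ [!c.isLatin] := by
        simpa using hpat
      have := (List.append_inj' this rfl).2
      rw [hcd'] at this
      simp at this
    · have hx : x = c.isLatin := by
        rw [hd] at hpat
        have : z'.map Gen.isLatin ++ [d.isLatin] =
            (List.replicate f c.isLatin ++ (!c.isLatin) :: r') ++ [x] := by simpa using hpat
        have := (List.append_inj' this rfl).2
        rw [hcd'] at this
        simpa using this.symm
      rw [hx, List.concat_eq_append] at hpat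
      obtain ⟨h1, h2, h3⟩ := derBound_of_run c.isLatin f hw hone hu hfix hpat
      refine ⟨h1, h2, h3.trans ?_⟩
      simp only [List.concat_eq_append, List.length_append, List.length_singleton] at hlen
      omega

/-! ### Fixed points of primitive morphisms -/

theorem pow_elem_fixed_of_forall {w : List Gen} {c : Fin 2}
    (h : ∀ g ∈ w, elem g (of c) = of c) (k : ℕ) : (phi w ^ k) (of c) = of c := by
  have h1 : phi w (of c) = of c := by
    induction w with
    | nil => simp
    | cons g w ih =>
      rw [phi_cons]
      change elem g (phi w (of c)) = _
      rw [ih fun g hg => h g (List.mem_cons_of_mem _ hg), h g List.mem_cons_self]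
  induction k with
  | zero => simp
  | succ k ih =>
    rw [pow_succ']
    change phi w ((phi w ^ k) (of c)) = _
    rw [ih, h1]

/-- The name of a primitive morphism contains letters of both alphabets. -/
theorem IsPrimitive.mem_map_isLatin {w : List Gen} (h : IsPrimitive (phi w)) (L : Bool) :
    L ∈ w.map Gen.isLatin := by
  obtain ⟨k, -, hk⟩ := h
  by_contra hL
  have hL' : ∀ g ∈ w, g.isLatin = !L := fun g hg => by
    have : g.isLatin ≠ L := fun h => hL (h ▸ List.mem_map_of_mem hg)
    revert this
    cases g.isLatin <;> cases L <;> simp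
  cases L
  · have := hk 1 0
    rw [pow_elem_fixed_of_forall fun g hg => ?_, mem_of] at this
    · simp at this
    · have := hL' g hg
      cases g <;> first | rfl | simp [Gen.isLatin] at this
  · have := hk 0 1
    rw [pow_elem_fixed_of_forall fun g hg => ?_, mem_of] at this
    · simp at this
    · have := hL' g hg
      cases g <;> first | rfl | simp [Gen.isLatin] at this

theorem IsFixedPoint.pow_pref {ψ : Morph} {u : InfWord} (h : IsFixedPoint ψ u) (n k : ℕ) :
    ∃ N, (ψ ^ k) (pref u n) = pref u N := by
  induction k with
  | zero => exact ⟨n, by simp⟩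
  | succ k ih =>
    obtain ⟨N, hN⟩ := ih
    refine ⟨cut ψ u N, ?_⟩
    rw [pow_succ']
    change ψ ((ψ ^ k) (pref u n)) = _
    rw [hN, IsImage.map_pref h]

theorem exists_of_mem_pref {u : InfWord} {n : ℕ} {c : Fin 2} (h : c ∈ pref u n) :
    ∃ i < n, u i = c := by
  have h1 : c ∈ List.ofFn fun t : Fin n => u (0 + t) := h
  rw [List.mem_ofFn] at h1
  obtain ⟨t, ht⟩ := h1
  exact ⟨t, t.2, by simpa using ht⟩

theorem IsFixedPoint.full {ψ : Morph} {u : InfWord} (h : IsFixedPoint ψ u) (hp : IsPrimitive ψ) :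
    Full u := fun c => by
  obtain ⟨k, -, hk⟩ := hp
  obtain ⟨N, hN⟩ := h.pow_pref 1 k
  have := hk c (u 0)
  have h1 : pref u 1 = of (u 0) := factor_one u 0
  rw [← h1, hN] at this
  obtain ⟨i, -, hi⟩ := exists_of_mem_pref this
  exact ⟨i, hi⟩

theorem countP_pos_of_not_inAAlpha {w : List Gen} (h : ¬ InAAlpha w) :
    0 < w.countP Gen.isOne := by
  rw [List.countP_pos_iff]
  by_contra hc
  refine h fun g hg => ?_
  have : ¬ g.isOne := fun h1 => hc ⟨g, hg, h1⟩
  cases g <;> simp [Gen.isOne] at this ⊢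

theorem derBound_of_isNormalizedName {w : List Gen} {u : InfWord} (hw : ¬ InAAlpha w)
    (hn : IsNormalizedName (phi w) w) (hp : IsPrimitive (phi w)) (hu : IsFixedPoint (phi w) u) :
    2 ≤ w.length ∧ DerBound (3 * w.length - 4) u :=
  derBound_of_normalized hn.admissible (countP_pos_of_not_inAAlpha hw) (hu.full hp)
    ((isFixedPoint_iff w u).1 hu) hp.mem_map_isLatin

/-! ### Existence of fixed points -/

/-- A morphism that prolongs a letter has a fixed point. -/
theorem exists_isFixedPoint {ψ : Morph} (hψ : NonErasing ψ) {c : Fin 2} {y : Word}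
    (hc : ψ (of c) = of c * y) (hy : y ≠ 1) : ∃ u, IsFixedPoint ψ u := by
  have hpow : ∀ k, NonErasing (ψ ^ k) := fun k => by
    induction k with
    | zero => exact NonErasing.one
    | succ k ih => rw [pow_succ]; exact ih.mul hψ
  set x : ℕ → Word := fun n => (ψ ^ n) (of c) with hx
  have hsucc : ∀ n, x (n + 1) = x n * (ψ ^ n) y := fun n => by
    change (ψ ^ (n + 1)) (of c) = (ψ ^ n) (of c) * (ψ ^ n) y
    rw [pow_succ, ← map_mul, ← hc]
    rfl
  have hψx : ∀ n, ψ (x n) = x (n + 1) := fun n => by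
    change ψ ((ψ ^ n) (of c)) = (ψ ^ (n + 1)) (of c)
    rw [pow_succ']
    rfl
  have hy1 : 1 ≤ y.length := Nat.pos_of_ne_zero fun h => hy (length_eq_zero.1 h)
  have hlen : ∀ n, n + 1 ≤ (x n).length := fun n => by
    induction n with
    | zero => simp [hx]
    | succ n ih =>
      rw [hsucc, length_mul]
      have := (hpow n).length_le y
      omega
  have hpre : ∀ n k, ∃ z, x (n + k) = x n * z := fun n k => by
    induction k with
    | zero => exact ⟨1, by simp⟩
    | succ k ih =>
      obtain ⟨z, hz⟩ := ih
      exact ⟨z * (ψ ^ (n + k)) y, by rw [← add_assoc, hsucc, hz, mul_assoc]⟩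
  have hget : ∀ n t, t < (x n).length → (toList (x n))[t]? = (toList (x t))[t]? := fun n t ht => by
    have key : ∀ i j, i ≤ j → t < (x i).length → (toList (x j))[t]? = (toList (x i))[t]? :=
      fun i j hij hi => by
        obtain ⟨z, hz⟩ := hpre i (j - i)
        rw [Nat.add_sub_cancel' hij] at hz
        rw [hz, toList_mul, List.getElem?_append_left hi]
    rcases le_total n t with h | h
    · exact (key n t h ht).symm
    · exact key t n h (hlen t)
  let u : InfWord := fun n => (toList (x n)).getD n 0
  have hpref : ∀ n, x n = pref u (x n).length := fun n => by
    apply (FreeMonoid.toList).injective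
    apply List.ext_getElem?
    intro t
    rcases lt_or_ge t (x n).length with ht | ht
    · have h1 : (toList (pref u (x n).length))[t]? = some (u t) := by
        simp [pref, factor, ht]
      have h2 : t < (toList (x t)).length := hlen t
      rw [h1, hget n t ht]
      simp only [u]
      rw [List.getD_eq_getElem?_getD, List.getElem?_eq_getElem h2]
      rfl
    · rw [List.getElem?_eq_none ht, List.getElem?_eq_none]
      exact (length_pref _ _).le.trans ht
  refine ⟨u, fun n => ?_, fun m => ⟨m, ?_⟩⟩
  · have h1 := pref_eq_mul_of_le u ((Nat.le_succ n).trans (hlen n))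
    rw [← hpref] at h1
    have h2 := hpref (n + 1)
    have h3 : (ψ (pref u n)).length ≤ (x (n + 1)).length := by
      rw [← hψx, h1, map_mul, length_mul]
      omega
    rw [pref_eq_mul_of_le u h3, ← hψx, h1, map_mul] at h2
    exact (mul_eq_mul_of_length h2 (length_pref _ _).symm).1
  · simpa using hψ.length_le (pref u m)

/-! ### Normalized names without competitors -/

/-- A name in which no rewriting rule applies in either direction is normalized. -/
theorem isNormalizedName_of_isolated {w : List Gen} (h1 : ∀ v, ¬ Step w v) (h2 : ∀ v, ¬ Step v w) :
    IsNormalizedName (phi w) w := by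
  refine ⟨w, rfl, Relation.EqvGen.refl w, fun v hv => Or.inl ?_⟩
  have key : ∀ x y, Relation.EqvGen Step x y → (x = w ↔ y = w) := fun x y hxy => by
    induction hxy with
    | rel x y h =>
      constructor
      · rintro rfl; exact absurd h (h1 _)
      · rintro rfl; exact absurd h (h2 _)
    | refl => rfl
    | symm _ _ _ ih => exact ih.symm
    | trans _ _ _ _ _ ih1 ih2 => exact ih1.trans ih2
  exact (key w v hv).1 rfl

/-! ### Roots of morphisms -/

/-- The number of occurrences of the letter `c`. -/
def cnt (c : Fin 2) (x : Word) : ℕ := (toList x).count c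

@[simp] theorem cnt_one (c : Fin 2) : cnt c 1 = 0 := by simp [cnt]

@[simp] theorem cnt_mul (c : Fin 2) (x y : Word) : cnt c (x * y) = cnt c x + cnt c y := by
  simp [cnt]

@[simp] theorem cnt_of (c d : Fin 2) : cnt c (of d) = if d = c then 1 else 0 := by
  simp [cnt, List.count_singleton]

@[simp] theorem cnt_pow (c : Fin 2) (x : Word) (k : ℕ) : cnt c (x ^ k) = k * cnt c x := by
  induction k with
  | zero => simp
  | succ k ih => rw [pow_succ, cnt_mul, ih]; ring

theorem cnt_map (ψ : Morph) (c : Fin 2) (x : Word) :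
    cnt c (ψ x) = cnt 0 x * cnt c (ψ (of 0)) + cnt 1 x * cnt c (ψ (of 1)) := by
  induction x using FreeMonoid.inductionOn' with
  | one => simp
  | of_mul d x ih =>
    rw [map_mul, cnt_mul, ih, cnt_mul, cnt_mul]
    fin_cases d <;> simp <;> ring

theorem cnt_pow_succ (η : Morph) (c d : Fin 2) (k : ℕ) :
    cnt c ((η ^ (k + 1)) (of d)) = cnt 0 (η (of d)) * cnt c ((η ^ k) (of 0)) +
      cnt 1 (η (of d)) * cnt c ((η ^ k) (of 1)) := by
  rw [pow_succ]
  exact cnt_map (η ^ k) c (η (of d))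

/-- The incidence matrices of the roots of exponent `k ≥ 2` of a morphism whose images of the
letters contain one `1`, and one or two letters `1`, respectively: the exponent is `2` and the
root has one of two shapes. -/
theorem root_cases {η : Morph} {k : ℕ} (hk : 2 ≤ k) (h0 : cnt 1 ((η ^ k) (of 0)) = 1)
    (h1 : 1 ≤ cnt 1 ((η ^ k) (of 1))) (h2 : cnt 1 ((η ^ k) (of 1)) ≤ 2)
    (h3 : 1 ≤ cnt 0 ((η ^ k) (of 1))) :
    k = 2 ∧ cnt 1 (η (of 0)) = 1 ∧
      (cnt 0 (η (of 0)) = 1 ∧ cnt 1 (η (of 1)) = 0 ∨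
        cnt 0 (η (of 0)) = 0 ∧ cnt 1 (η (of 1)) = 1) := by
  set p := cnt 0 (η (of 0)) with hp
  set q := cnt 0 (η (of 1)) with hq
  set r := cnt 1 (η (of 0)) with hr
  set s := cnt 1 (η (of 1)) with hs
  obtain ⟨f, hf⟩ : ∃ f : ℕ → ℕ, f = fun j => cnt 1 ((η ^ j) (of 0)) := ⟨_, rfl⟩
  obtain ⟨g, hg⟩ : ∃ g : ℕ → ℕ, g = fun j => cnt 1 ((η ^ j) (of 1)) := ⟨_, rfl⟩
  obtain ⟨G, hG⟩ : ∃ G : ℕ → ℕ, G = fun j => cnt 0 ((η ^ j) (of 1)) := ⟨_, rfl⟩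
  have hf0 : f 0 = 0 := by simp [hf]
  have hg0 : g 0 = 1 := by simp [hg]
  have hG0 : G 0 = 0 := by simp [hG]
  have hfs : ∀ j, f (j + 1) = p * f j + r * g j := fun j => by
    rw [hf, hg]; exact cnt_pow_succ η 1 0 j
  have hgs : ∀ j, g (j + 1) = q * f j + s * g j := fun j => by
    rw [hf, hg]; exact cnt_pow_succ η 1 1 j
  have hGs : ∀ j, G (j + 1) = q * cnt 0 ((η ^ j) (of 0)) + s * G j := fun j => by
    rw [hG]; exact cnt_pow_succ η 0 1 j
  have h0 : f k = 1 := by rw [hf]; exact h0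
  have h1 : 1 ≤ g k := by rw [hg]; exact h1
  have h2 : g k ≤ 2 := by rw [hg]; exact h2
  have h3 : 1 ≤ G k := by rw [hG]; exact h3
  have hq1 : 1 ≤ q := by
    by_contra hq0
    have hq0 : q = 0 := by omega
    have : ∀ j, G j = 0 := fun j => by
      induction j with
      | zero => exact hG0
      | succ j ih => rw [hGs, hq0, ih]; simp
    rw [this] at h3
    omega
  have hr1 : 1 ≤ r := by
    by_contra hr0
    have hr0 : r = 0 := by omega
    have : ∀ j, f j = 0 := fun j => by
      induction j with
      | zero => exact hf0
      | succ j ih => rw [hfs, hr0, ih]; simp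
    rw [this] at h0
    omega
  have hps : 1 ≤ p ∨ 1 ≤ s := by
    by_contra hps
    have hp0 : p = 0 := by omega
    have hs0 : s = 0 := by omega
    have : ∀ j, f j = 0 ∨ g j = 0 := fun j => by
      induction j with
      | zero => exact Or.inl hf0
      | succ j ih =>
        rw [hfs, hgs, hp0, hs0]
        rcases ih with h | h <;> simp [h]
    rcases this k with h | h <;> omega
  have hgpos : 1 ≤ s → ∀ j, 1 ≤ g j := fun hs1 j => by
    induction j with
    | zero => omega
    | succ j ih => rw [hgs]; nlinarith [Nat.zero_le (q * f j)]
  have hfpos : ∀ j, 1 ≤ f (j + 1) := fun j => by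
    rcases hps with h | h
    · induction j with
      | zero => rw [hfs, hf0, hg0]; omega
      | succ j ih => rw [hfs]; nlinarith [Nat.zero_le (r * g (j + 1))]
    · rw [hfs]; nlinarith [Nat.zero_le (p * f j), hgpos h j]
  have hgpos2 : ∀ j, 1 ≤ g (j + 2) := fun j => by
    rw [hgs]; nlinarith [hfpos j, Nat.zero_le (s * g (j + 1))]
  obtain ⟨j, rfl⟩ := Nat.exists_eq_add_of_le' hk
  rcases j with _ | j
  · refine ⟨rfl, ?_⟩
    have h4 : r * (p + s) = 1 := by
      have e1 : f 2 = p * f 1 + r * g 1 := hfs 1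
      have e2 : f 1 = p * f 0 + r * g 0 := hfs 0
      have e3 : g 1 = q * f 0 + s * g 0 := hgs 0
      rw [hf0, hg0] at e2 e3
      have e4 : f 2 = 1 := h0
      rw [e1, e2, e3] at e4
      linarith
    have h5 := Nat.eq_one_of_mul_eq_one_right h4
    rw [h5] at h4
    omega
  · exfalso
    have e1 : p * f (j + 2) + r * g (j + 2) = 1 := by rw [← hfs]; exact h0
    have hp0 : p = 0 := by
      by_contra hp0
      have : 1 ≤ p * f (j + 2) := Nat.mul_pos (by omega) (hfpos (j + 1))
      have : 1 ≤ r * g (j + 2) := Nat.mul_pos hr1 (hgpos2 j)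
      omega
    have hs1 : 1 ≤ s := by omega
    rw [hp0, Nat.zero_mul, Nat.zero_add] at e1
    have hg2 : g (j + 2) = 1 := Nat.eq_one_of_mul_eq_one_left e1
    have e2 : g (j + 2) = q * f (j + 1) + s * g (j + 1) := hgs _
    have : 1 ≤ q * f (j + 1) := Nat.mul_pos hq1 (hfpos j)
    have : 1 ≤ s * g (j + 1) := Nat.mul_pos hs1 (hgpos hs1 _)
    omega

theorem cnt_add_cnt (x : Word) : cnt 0 x + cnt 1 x = x.length := by
  induction x using FreeMonoid.inductionOn' with
  | one => simp
  | of_mul d x ih =>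
    rw [cnt_mul, cnt_mul, length_mul, ← ih, length_of]
    fin_cases d <;> simp <;> ring

/-! ### The names `a^m β` -/

theorem elem_a_pow (k : ℕ) : (elem .a ^ k) (of 0) = of 0 ∧
    (elem .a ^ k) (of 1) = of 1 * of 0 ^ k := by
  induction k with
  | zero => simp
  | succ k ih =>
    have h0 : elem .a (of 0) = of 0 := rfl
    have h1 : elem .a (of 1) = of 1 * of 0 := rfl
    simp only [pow_succ', Monoid.End.coe_mul, Function.comp_apply, ih, map_mul, map_pow, h0, h1,
      true_and]
    rw [mul_assoc]

theorem elem_b_pow (k : ℕ) : (elem .b ^ k) (of 0) = of 0 ∧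
    (elem .b ^ k) (of 1) = of 0 ^ k * of 1 := by
  induction k with
  | zero => simp
  | succ k ih =>
    have h0 : elem .b (of 0) = of 0 := rfl
    have h1 : elem .b (of 1) = of 0 * of 1 := rfl
    simp only [pow_succ', Monoid.End.coe_mul, Function.comp_apply, ih, map_mul, map_pow, h0, h1,
      true_and]
    rw [← mul_assoc, ← pow_succ, pow_succ']

/-- The name `a^m β`. -/
def nameMin (m : ℕ) : List Gen := List.replicate m .a ++ [.β]

theorem phi_nameMin (m : ℕ) : phi (nameMin m) (of 0) = of 1 * of 0 ^ (m + 1) ∧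
    phi (nameMin m) (of 1) = of 1 * of 0 ^ m := by
  have h0 : elem .β (of 0) = of 1 * of 0 := rfl
  have h1 : elem .β (of 1) = of 1 := rfl
  have h : phi (nameMin m) = elem .a ^ m * elem .β := by simp [nameMin, phi_replicate]
  rw [h]
  simp only [Monoid.End.coe_mul, Function.comp_apply, h0, h1, map_mul, elem_a_pow]
  exact ⟨by rw [mul_assoc, ← pow_succ], trivial⟩

theorem nameMin_isolated (m : ℕ) (x y : List Gen) (h : Step x y) :
    x ≠ nameMin m ∧ y ≠ nameMin m := by
  have hα : Gen.α ∉ nameMin m := by simp [nameMin, List.mem_replicate]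
  have hb : Gen.b ∉ nameMin m := by simp [nameMin, List.mem_replicate]
  cases h with
  | greek x y k =>
    exact ⟨fun h => hα (by rw [← h]; simp), fun h => hα (by rw [← h]; simp)⟩
  | latin x y k =>
    exact ⟨fun h => hb (by rw [← h]; simp), fun h => hb (by rw [← h]; simp)⟩

theorem mem_of_cnt_pos {c : Fin 2} {x : Word} (h : 0 < cnt c x) : c ∈ x :=
  List.count_pos_iff.1 h

theorem isPrimitive_nameMin {m : ℕ} (hm : 1 ≤ m) : IsPrimitive (phi (nameMin m)) := by
  refine ⟨1, one_pos, fun x y => mem_of_cnt_pos ?_⟩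
  obtain ⟨h0, h1⟩ := phi_nameMin m
  rw [pow_one]
  fin_cases x <;> fin_cases y <;> (simp [h0, h1]; try omega)

theorem notPowerOfOther_nameMin {m : ℕ} (hm : 1 ≤ m) : NotPowerOfOther (phi (nameMin m)) := by
  intro η k _ hη
  obtain ⟨h0, h1⟩ := phi_nameMin m
  rcases k with _ | _ | k
  · have := congrArg (fun ψ : Morph => cnt 1 (ψ (of 0))) hη
    simp [h0] at this
  · rw [hη]; simp
  · exfalso
    rw [hη] at h0 h1
    obtain ⟨hk, hr, h | h⟩ := root_cases (η := η) (k := k + 1 + 1) (by omega) (by rw [h0]; simp)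
      (by rw [h1]; simp) (by rw [h1]; simp) (by rw [h1]; simpa using hm)
    · obtain rfl : k = 0 := by omega
      have e1 := cnt_pow_succ η 1 1 1
      rw [show (1 + 1 : ℕ) = 0 + 1 + 1 from rfl, h1, pow_one, hr, h.2] at e1
      have hq : cnt 0 (η (of 1)) = 1 := by simpa using e1.symm
      -- `η(1)` is the letter `0`, and so `η(0)` is `01` or `10`: both give `η²(0)` first letter `0`.
      have hη1 : η (of 1) = of 0 := by
        have hl := cnt_add_cnt (η (of 1))
        rw [hq, h.2] at hl
        obtain ⟨c, hc⟩ := length_eq_one.1 hl.symm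
        rw [hc, cnt_of] at hq
        rw [hc]
        congr 1
        by_contra hc0
        simp [hc0] at hq
      have hl := cnt_add_cnt (η (of 0))
      rw [h.1, hr] at hl
      obtain ⟨c, d, hcd⟩ := length_eq_two.1 hl.symm
      have h0' : η (η (of 0)) = of 1 * of 0 ^ (m + 1) := by
        rw [← h0, zero_add, pow_succ, pow_one]
        rfl
      rcases (by decide : ∀ x : Fin 2, x = 0 ∨ x = 1) c with rfl | rfl
      · rw [hcd, map_mul, hcd, mul_assoc] at h0'
        have := (List.cons.inj h0').1
        simp at this
      · rw [hcd, map_mul, hη1] at h0'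
        have := (List.cons.inj h0').1
        simp at this
    · have e1 := cnt_pow_succ η 1 1 1
      obtain rfl : k = 0 := by omega
      rw [show (1 + 1 : ℕ) = 0 + 1 + 1 from rfl, h1, pow_one, hr, h.2] at e1
      have e2 := cnt_pow_succ η 0 1 1
      rw [show (1 + 1 : ℕ) = 0 + 1 + 1 from rfl, h1, pow_one, h.1, h.2] at e2
      simp at e1 e2
      omega

theorem ncard_Der_nameMin {m : ℕ} {u : InfWord} (hu : Full u) (hfix : act (nameMin m) u = u) :
    (Der u).ncard = 1 := by
  have hfirst : ∀ k l, first (List.replicate k .a ++ [.β]) l = 1 := fun k l => by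
    induction k with
    | zero => rfl
    | succ k ih => exact ih
  have hu0 : u 0 = 1 := by
    have := act_apply_zero (nameMin m) u
    rwa [hfix, nameMin, hfirst] at this
  have hadm : ∀ k, Admissible (u 0) (u 0) (List.replicate k .a ++ [.β]) := fun k => by
    induction k with
    | zero => trivial
    | succ k ih => exact ⟨hfirst k _, ih⟩
  have hst : ∀ k, states (List.replicate k .a ++ [.β]) u = {letterClass u} := fun k => by
    induction k with
    | zero => simp [states, Gen.isOne]
    | succ k ih => exact ih
  rw [Der_eq_states hu (hadm m) (List.countP_pos_iff.2 ⟨.β, by simp, rfl⟩) hfix, hst]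
  simp

theorem exists_isFixedPoint_nameMin {m : ℕ} (hm : 1 ≤ m) :
    ∃ u, IsFixedPoint (phi (nameMin m)) u := by
  refine exists_isFixedPoint (nonErasing_phi _) (phi_nameMin m).2 fun h => ?_
  have := congrArg (cnt 0) h
  simp at this
  omega

/-! ### The names `b^m α a` -/

/-- The name `b^m α a`. -/
def nameMax (m : ℕ) : List Gen := List.replicate m .b ++ [.α, .a]

theorem phi_nameMax (m : ℕ) : phi (nameMax m) (of 0) = of 0 ^ (m + 1) * of 1 ∧
    phi (nameMax m) (of 1) = of 0 ^ m * of 1 * (of 0 ^ (m + 1) * of 1) := by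
  have h0 : elem .α (of 0) = of 0 * of 1 := rfl
  have h1 : elem .α (of 1) = of 1 := rfl
  have h2 : elem .a (of 0) = of 0 := rfl
  have h3 : elem .a (of 1) = of 1 * of 0 := rfl
  have h : phi (nameMax m) = elem .b ^ m * (elem .α * elem .a) := by
    simp [nameMax, phi_replicate]
  rw [h]
  simp only [Monoid.End.coe_mul, Function.comp_apply, h0, h1, h2, h3, map_mul, elem_b_pow]
  exact ⟨by rw [← mul_assoc, ← pow_succ'], by rw [← mul_assoc (of 0) (of 0 ^ m), ← pow_succ']⟩

theorem nameMax_isolated (m : ℕ) (x y : List Gen) (h : Step x y) :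
    x ≠ nameMax m ∧ y ≠ nameMax m := by
  have hβ : Gen.β ∉ nameMax m := by simp [nameMax, List.mem_replicate]
  -- in `b^m α a`, the letter `a` is the last one and does not follow a letter `b`
  have hc : List.IsChain (fun c d : Gen => c ≠ .a ∧ ¬ (c = .b ∧ d = .a)) (nameMax m) := by
    unfold nameMax
    clear h hβ
    induction m with
    | zero => simp
    | succ m ih =>
      rw [List.replicate_succ, List.cons_append, List.isChain_cons]
      refine ⟨fun d hd => ?_, ih⟩
      rcases m with _ | m
      · simp at hd; subst hd; simp
      · simp [List.replicate_succ] at hd; subst hd; simp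
  cases h with
  | greek x y k =>
    exact ⟨fun h => hβ (by rw [← h]; simp), fun h => hβ (by rw [← h]; simp)⟩
  | latin x y k =>
    constructor
    · intro h
      rw [← h] at hc
      have h1 := (List.isChain_append.1 (List.isChain_append.1 hc).1).2.1
      rw [List.cons_append, List.isChain_cons] at h1
      rcases k with _ | k
      · exact (h1.1 .b (by simp)).1 rfl
      · exact (h1.1 .α (by simp [List.replicate_succ])).1 rfl
    · intro h
      rcases k with _ | k
      · rw [← h] at hc
        have h1 := (List.isChain_append.1 (List.isChain_append.1 hc).1).2.1
        simp at h1
      · exact hβ (by rw [← h]; simp)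

theorem isPrimitive_nameMax (m : ℕ) : IsPrimitive (phi (nameMax m)) := by
  refine ⟨1, one_pos, fun x y => mem_of_cnt_pos ?_⟩
  obtain ⟨h0, h1⟩ := phi_nameMax m
  rw [pow_one]
  fin_cases x <;> fin_cases y <;> simp [h0, h1]

theorem notPowerOfOther_nameMax {m : ℕ} (hm : 1 ≤ m) : NotPowerOfOther (phi (nameMax m)) := by
  intro η k _ hη
  obtain ⟨h0, h1⟩ := phi_nameMax m
  rcases k with _ | _ | k
  · have := congrArg (fun ψ : Morph => cnt 1 (ψ (of 0))) hη
    simp [h0] at this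
  · rw [hη]; simp
  · exfalso
    rw [hη] at h0 h1
    obtain ⟨hk, hr, h⟩ := root_cases (η := η) (k := k + 1 + 1) (by omega) (by rw [h0]; simp)
      (by rw [h1]; simp) (by rw [h1]; simp) (by rw [h1]; simp; omega)
    obtain rfl : k = 0 := by omega
    have e1 := cnt_pow_succ η 1 1 1
    have e2 := cnt_pow_succ η 0 1 1
    have e3 := cnt_pow_succ η 0 0 1
    rw [show (1 + 1 : ℕ) = 0 + 1 + 1 from rfl, h1, pow_one, hr] at e1
    rw [show (1 + 1 : ℕ) = 0 + 1 + 1 from rfl, h1, pow_one] at e2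
    rw [show (1 + 1 : ℕ) = 0 + 1 + 1 from rfl, h0, pow_one, hr] at e3
    rcases h with ⟨hp, hs⟩ | ⟨hp, hs⟩ <;>
      (rw [hs] at e1; rw [hp, hs] at e2; rw [hp] at e3; simp at e1 e2 e3; omega)

theorem exists_isFixedPoint_nameMax (m : ℕ) : ∃ u, IsFixedPoint (phi (nameMax m)) u := by
  refine exists_isFixedPoint (nonErasing_phi _) (c := 0) (y := of 0 ^ m * of 1) ?_ fun h => ?_
  · rw [(phi_nameMax m).1, pow_succ', mul_assoc]
  · have := congrArg (cnt 1) h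
    simp at this

/-! ### The directive word for `b^m α a` -/

theorem phi_a_comm_b (m : ℕ) : elem .a * elem .b ^ m = elem .b ^ m * elem .a := by
  have h : Commute (elem .a) (elem .b) := by
    have := phi_latin 0
    simp only [List.replicate_zero, List.cons_append, List.nil_append, phi_cons, phi_nil,
      mul_one] at this
    exact this
  exact h.pow_right m

/-- The carry `a α b^m b = b β b^m a`. -/
theorem phi_aα_comm (m : ℕ) : elem .a * elem .α * elem .b ^ (m + 1) =
    elem .b * elem .β * elem .b ^ m * elem .a := by
  have h := phi_carry (x := .α :: List.replicate m .b) (by simp [List.mem_replicate])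
  simp only [phi_append, phi_cons, phi_nil, phi_replicate, List.map_cons, List.map_replicate,
    Gen.up, mul_one] at h
  rw [pow_succ, ← mul_assoc, mul_assoc (elem .a), h, ← mul_assoc (elem .b)]

/-- The fixed point of `φ_w`, `w = b^m α a`, has the directive word
`b^m α b^{m+1} (β b^m a)(β b^m a) ⋯`. -/
theorem exists_directive_nameMax {m : ℕ} (hm : 1 ≤ m) {u : InfWord}
    (hfix : act (nameMax m) u = u) :
    ∃ w, act (List.replicate m .b ++ .α :: List.replicate (m + 1) .b) (act w u) = u ∧
      act (.β :: (List.replicate m .b ++ [.a])) (act w u) = act w u := by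
  obtain ⟨m, rfl⟩ := Nat.exists_eq_succ_of_ne_zero (by omega : m ≠ 0)
  set w := Gen.β :: (List.replicate m .b ++ [.a, .a, .α, .a]) with hw
  have hcarry := phi_aα_comm m
  have hcomm := phi_a_comm_b (m + 1)
  have hN : phi (nameMax (m + 1)) = elem .b ^ (m + 1) * elem .α * elem .a := by
    simp [nameMax, phi_replicate, mul_assoc]
  have hphiw : phi w = elem .β * elem .b ^ m * elem .a * elem .a * elem .α * elem .a := by
    simp [hw, phi_replicate, mul_assoc]
  refine ⟨w, ?_, ?_⟩
  · have h3 : act (nameMax (m + 1) ++ (nameMax (m + 1) ++ nameMax (m + 1))) u = u := by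
      rw [act_append, act_append, hfix, hfix, hfix]
    rw [← act_append]
    refine (act_congr ?_ u).trans h3
    rw [phi_append, phi_append (nameMax _), phi_append (nameMax _), hphiw, hN]
    simp only [phi_append, phi_cons, phi_replicate]
    calc elem .b ^ (m + 1) * (elem .α * elem .b ^ (m + 1 + 1)) *
          (elem .β * elem .b ^ m * elem .a * elem .a * elem .α * elem .a)
        = elem .b ^ (m + 1) * elem .α * elem .b ^ (m + 1) *
          (elem .b * elem .β * elem .b ^ m * elem .a) * elem .a * elem .α * elem .a := by
          rw [pow_succ _ (m + 1)]; simp only [mul_assoc]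
      _ = elem .b ^ (m + 1) * elem .α * (elem .b ^ (m + 1) * elem .a) * elem .α *
          (elem .b ^ (m + 1) * elem .a) * elem .α * elem .a := by
          rw [← hcarry]; simp only [mul_assoc]
      _ = _ := by rw [← hcomm]; simp only [mul_assoc]
  · have h3 : act w (act (nameMax (m + 1)) u) = act w u := by rw [hfix]
    rw [← act_append]
    refine Eq.trans (act_congr ?_ u) ((act_append _ _ _).trans h3)
    rw [phi_append, phi_append w, hphiw, hN]
    simp only [phi_append, phi_cons, phi_replicate, phi_nil, mul_one]
    calc elem .β * (elem .b ^ (m + 1) * elem .a) *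
          (elem .β * elem .b ^ m * elem .a * elem .a * elem .α * elem .a)
        = elem .β * elem .b ^ m * (elem .b ^ 1 * elem .a) * elem .β * elem .b ^ m * elem .a *
          elem .a * elem .α * elem .a := by
          rw [pow_succ, pow_one]; simp only [mul_assoc]
      _ = elem .β * elem .b ^ m * elem .a * (elem .b * elem .β * elem .b ^ m * elem .a) *
          elem .a * elem .α * elem .a := by
          rw [← phi_a_comm_b 1, pow_one]; simp only [mul_assoc]
      _ = elem .β * elem .b ^ m * elem .a * elem .a * elem .α * (elem .b ^ (m + 1) * elem .a) *
          elem .α * elem .a := by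
          rw [← hcarry]; simp only [mul_assoc]
      _ = _ := by rw [← hcomm]; simp only [mul_assoc]

/-! ### Distinguishing the derivated words -/

theorem isOcc_mul (u : InfWord) (x y : Word) (i : ℕ) :
    IsOcc u (x * y) i ↔ IsOcc u x i ∧ IsOcc u y (i + x.length) := by
  unfold IsOcc
  rw [length_mul, factor_add]
  constructor
  · intro h
    exact mul_eq_mul_of_length h (length_factor _ _ _)
  · rintro ⟨h1, h2⟩
    rw [h1, h2]

theorem isOcc_of (u : InfWord) (c : Fin 2) (i : ℕ) : IsOcc u (of c) i ↔ u i = c := by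
  unfold IsOcc
  rw [length_of, factor_one]
  exact of_injective.eq_iff

theorem isOcc_of_pow (u : InfWord) (c : Fin 2) (k i : ℕ) :
    IsOcc u (of c ^ k) i ↔ ∀ t < k, u (i + t) = c := by
  have hlen : ∀ k, (of c ^ k).length = k := fun k => by
    induction k with
    | zero => simp
    | succ k ih => rw [pow_succ, length_mul, ih, length_of]
  induction k with
  | zero => simp [IsOcc]
  | succ k ih =>
    rw [pow_succ, isOcc_mul, isOcc_of, hlen,
      show IsOcc u (of c ^ k) i ↔ ∀ t < k, u (i + t) = c from ih]
    constructor
    · rintro ⟨h1, h2⟩ t ht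
      rcases Nat.lt_succ_iff_lt_or_eq.1 ht with h | rfl
      · exact h1 t h
      · exact h2
    · exact fun h => ⟨fun t ht => h t (by omega), h k (by omega)⟩

theorem length_pow_word (x : Word) (k : ℕ) : (x ^ k).length = k * x.length := by
  induction k with
  | zero => simp
  | succ k ih => rw [pow_succ, length_mul, ih]; ring

theorem isOcc_act {u : InfWord} {x : Word} (h : IsOcc u x 0) (y : List Gen) :
    IsOcc (act y u) (phi y x) 0 := by
  have h1 : pref u x.length = x := h
  have h2 := (isImage_act y u).map_pref x.length
  rw [h1] at h2
  have h3 := congrArg FreeMonoid.length h2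
  rw [length_pref] at h3
  unfold IsOcc
  rw [h3]
  exact h2.symm

/-- The word `u` starts with `0^p 1 0^q 1`. -/
def Shape (p q : ℕ) (u : InfWord) : Prop := IsOcc u (of 0 ^ p * of 1 * (of 0 ^ q * of 1)) 0

theorem shape_iff (p q : ℕ) (u : InfWord) : Shape p q u ↔
    ((∀ t < p, u t = 0) ∧ u p = 1) ∧ (∀ t < q, u (p + 1 + t) = 0) ∧ u (p + 1 + q) = 1 := by
  simp [Shape, isOcc_mul, isOcc_of, isOcc_of_pow, length_pow_word]

theorem Shape.unique {p q p' q' : ℕ} {u : InfWord} (h : Shape p q u) (h' : Shape p' q' u) :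
    p = p' ∧ q = q' := by
  rw [shape_iff] at h h'
  obtain ⟨⟨h1, h2⟩, h3, h4⟩ := h
  obtain ⟨⟨h1', h2'⟩, h3', h4'⟩ := h'
  have hp : p = p' := by
    rcases lt_trichotomy p p' with hlt | heq | hlt
    · rw [h1' p hlt] at h2; simp at h2
    · exact heq
    · rw [h1 p' hlt] at h2'; simp at h2'
  subst hp
  refine ⟨rfl, ?_⟩
  rcases lt_trichotomy q q' with hlt | heq | hlt
  · rw [h3' q hlt] at h4; simp at h4
  · exact heq
  · rw [h3 q' hlt] at h4'; simp at h4'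

/-- Words over two letters that differ by a permutation of letters are equal or complementary. -/
theorem eq_or_compl_of_letterClass {u v : InfWord} (h : letterClass u = letterClass v) :
    u = v ∨ ∀ i, v i ≠ u i := by
  obtain ⟨σ, hσ⟩ : ∃ σ : Equiv.Perm ℕ, ∀ i, (v i : ℕ) = σ (u i : ℕ) := Quotient.exact h
  have hiff : ∀ i j, v i = v j ↔ u i = u j := fun i j => by
    rw [Fin.ext_iff, hσ, hσ, σ.injective.eq_iff, Fin.ext_iff]
  have key : ∀ a b c d : Fin 2, (a = b ↔ c = d) → (b = d → c = a) ∧ (b ≠ d → a ≠ c) := by decide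
  by_cases h0 : v 0 = u 0
  · exact Or.inl (funext fun i => (key _ _ _ _ (hiff i 0)).1 h0)
  · exact Or.inr fun i => (key _ _ _ _ (hiff i 0)).2 h0

theorem states_replicate_b (k : ℕ) (y : InfWord) :
    states (List.replicate k .b) y =
      (fun i => letterClass (act (List.replicate i .b) y)) '' (Set.Iio k) := by
  induction k with
  | zero =>
    rw [show Set.Iio 0 = (∅ : Set ℕ) by ext; simp]
    simp [states]
  | succ k ih =>
    have : Set.Iio (k + 1) = insert k (Set.Iio k) := by
      ext j; simp only [Set.mem_Iio, Set.mem_insert_iff]; omega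
    rw [this, Set.image_insert_eq, List.replicate_succ, states, if_pos (by rfl), ih]

theorem phi_replicate_b (i : ℕ) : phi (List.replicate i .b) (of 0) = of 0 ∧
    phi (List.replicate i .b) (of 1) = of 0 ^ i * of 1 := by
  rw [phi_replicate]
  exact elem_b_pow i

/-- The words from which the derivated words of the fixed point for `b^m α a` arise by powers of
`φ_b`; here `v` is the fixed point for `β b^m a`. -/
def seed (m : ℕ) (v : InfWord) : ℕ → InfWord
  | 0 => act (.α :: List.replicate (m + 1) .b) v
  | 1 => v
  | _ => act [.a] v

/-- A long enough prefix of the fixed point for `β b^m a`. -/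
theorem isOcc_of_fixed {m : ℕ} {v : InfWord}
    (hfix : act (.β :: (List.replicate m .b ++ [.a])) v = v) :
    IsOcc v ((of 1 * of 0) ^ m * of 1 * (of 1 * of 0)) 0 := by
  have h1 : v 0 = 1 := by
    have := act_apply_zero (.β :: (List.replicate m .b ++ [.a])) v
    rwa [hfix] at this
  have h2 := isOcc_act ((isOcc_of v 1 0).2 h1) (.β :: (List.replicate m .b ++ [.a]))
  rw [hfix] at h2
  have ea : elem .a (of 1) = of 1 * of 0 := rfl
  have e0 : elem .β (of 0) = of 1 * of 0 := rfl
  have e1 : elem .β (of 1) = of 1 := rfl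
  have e : phi (.β :: (List.replicate m .b ++ [.a])) (of 1) =
      (of 1 * of 0) ^ m * of 1 * (of 1 * of 0) := by
    rw [phi_cons, phi_append]
    change elem .β (phi (List.replicate m .b) (phi [.a] (of 1))) = _
    rw [phi_cons, phi_nil, mul_one, ea, map_mul, (phi_replicate_b m).1, (phi_replicate_b m).2]
    simp only [map_mul, map_pow, e0, e1]
  rwa [e] at h2

section Seeds

variable {m : ℕ} {v : InfWord}

theorem isOcc_one_zero_one (hm : 1 ≤ m)
    (hv : IsOcc v ((of 1 * of 0) ^ m * of 1 * (of 1 * of 0)) 0) :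
    IsOcc v (of 1 * of 0 * of 1) 0 := by
  obtain ⟨k, rfl⟩ := Nat.exists_eq_succ_of_ne_zero (by omega : m ≠ 0)
  have hs : SemiconjBy (of 1 : Word) ((of 0 * of 1) ^ k) ((of 1 * of 0) ^ k) :=
    SemiconjBy.pow_right (mul_assoc _ _ _).symm k
  have e : ((of 1 * of 0) ^ (k + 1) * of 1 * (of 1 * of 0) : Word) =
      of 1 * of 0 * of 1 * ((of 0 * of 1) ^ k * (of 1 * of 0)) := by
    rw [pow_succ']
    simp only [mul_assoc]
    rw [← mul_assoc ((of 1 * of 0) ^ k : Word) (of 1), ← hs.eq]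
    simp only [mul_assoc]
  rw [Nat.succ_eq_add_one, e, isOcc_mul] at hv
  exact hv.1

/-- The position of the first two letters `1` in the derivated words. -/
theorem shape_seed (hm : 1 ≤ m)
    (hv : IsOcc v ((of 1 * of 0) ^ m * of 1 * (of 1 * of 0)) 0) (i : ℕ) {t : ℕ} (ht : t ≤ 2) :
    Shape (i + if t = 0 then 1 else 0) ((i + if t = 0 then 1 else 0) + t)
      (act (List.replicate i .b) (seed m v t)) := by
  have h101 := isOcc_one_zero_one hm hv
  obtain ⟨b0, b1⟩ := phi_replicate_b i
  have a0 : elem .a (of 0) = of 0 := rfl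
  have a1 : elem .a (of 1) = of 1 * of 0 := rfl
  have α0 : elem .α (of 0) = of 0 * of 1 := rfl
  have α1 : elem .α (of 1) = of 1 := rfl
  unfold Shape
  interval_cases t
  · obtain ⟨k, rfl⟩ := Nat.exists_eq_succ_of_ne_zero (by omega : m ≠ 0)
    have h1 : IsOcc v (of 1) 0 := ((isOcc_mul _ _ _ _).1 ((isOcc_mul _ _ _ _).1 h101).1).1
    have h2 := isOcc_act (isOcc_act h1 (.α :: List.replicate (k + 1 + 1) .b))
      (List.replicate i .b)
    have e : phi (.α :: List.replicate (k + 1 + 1) .b) (of 1) =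
        of 0 * of 1 * (of 0 * of 1) * ((of 0 * of 1) ^ k * of 1) := by
      rw [phi_cons]
      change elem .α (phi (List.replicate (k + 1 + 1) .b) (of 1)) = _
      rw [(phi_replicate_b _).2]
      simp only [map_mul, map_pow, α0, α1, pow_succ', mul_assoc]
    rw [e, map_mul, isOcc_mul] at h2
    simp only [if_true, Nat.add_zero]
    have e2 : phi (List.replicate i .b) (of 0 * of 1 * (of 0 * of 1)) =
        of 0 ^ (i + 1) * of 1 * (of 0 ^ (i + 1) * of 1) := by
      simp only [map_mul, b0, b1, pow_succ', mul_assoc]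
    rw [← e2]
    exact h2.1
  · have h2 := isOcc_act h101 (List.replicate i .b)
    have e2 : phi (List.replicate i .b) (of 1 * of 0 * of 1) =
        of 0 ^ i * of 1 * (of 0 ^ (i + 1) * of 1) := by
      simp only [map_mul, b0, b1, pow_succ', mul_assoc]
    rw [e2] at h2
    exact h2
  · have h2 := isOcc_act (isOcc_act h101 [.a]) (List.replicate i .b)
    have e2 : phi (List.replicate i .b) (phi [.a] (of 1 * of 0 * of 1)) =
        of 0 ^ i * of 1 * (of 0 ^ (i + 2) * of 1) * of 0 := by
      simp only [phi_cons, phi_nil, mul_one, map_mul, a0, a1, b0, b1, pow_succ', mul_assoc]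
    rw [e2, isOcc_mul] at h2
    exact h2.1

/-- The fixed point `v` for `β b^m a` is not complementary to `φ_b^i` of a seed. This is where
prefixes longer than those in `Shape` are needed. -/
theorem not_compl_fixed (hm : 1 ≤ m)
    (hfix : act (.β :: (List.replicate m .b ++ [.a])) v = v) {i t : ℕ} (ht : t ≤ 2)
    (hcompl : ∀ j, act (List.replicate i .b) (seed m v t) j ≠ v j)
    (hpos : 0 < i + if t = 0 then 1 else 0) (hi : t = 0 → i < m) : False := by
  have hv := isOcc_of_fixed hfix
  have h101 := isOcc_one_zero_one hm hv
  have hshape := shape_seed hm hv i ht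
  obtain ⟨⟨s1, s2⟩, s3, s4⟩ := (shape_iff _ _ _).1 hshape
  obtain ⟨⟨v0, v1⟩, v2⟩ : (v 0 = 1 ∧ v 1 = 0) ∧ v 2 = 1 := by
    simpa [isOcc_mul, isOcc_of] using h101
  have hx1 : act (List.replicate i .b) (seed m v t) 1 = 1 := by
    have := hcompl 1
    rw [v1] at this
    exact (by decide : ∀ c : Fin 2, c ≠ 0 → c = 1) _ this
  have hp : (i + if t = 0 then 1 else 0) = 1 := by
    by_contra hne
    rw [s1 1 (by omega)] at hx1
    simp at hx1
  rw [hp] at s3 s4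
  have hlong : v (2 * m) = 1 ∧ v (2 * m + 1) = 1 := by
    rw [isOcc_mul, isOcc_mul, isOcc_mul] at hv
    have h1 := hv.1.2
    have h2 := hv.2.1
    rw [isOcc_of] at h1 h2
    simp only [length_mul, length_pow_word, length_of] at h1 h2
    constructor
    · rw [← h1]; congr 1; ring
    · rw [← h2]; congr 1; ring
  rcases Nat.eq_zero_or_pos t with rfl | htpos
  · -- the seed starts with `(01)^(m+1)`, the word `v` with `(10)^m 11`
    obtain rfl : i = 0 := by simpa using hp
    have h1 : IsOcc v (of 1) 0 := (isOcc_of _ _ _).2 v0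
    have h2 := isOcc_act h1 (.α :: List.replicate (m + 1) .b)
    have α0 : elem .α (of 0) = of 0 * of 1 := rfl
    have α1 : elem .α (of 1) = of 1 := rfl
    have e : phi (.α :: List.replicate (m + 1) .b) (of 1) =
        (of 0 * of 1) ^ m * (of 0 * of 1) * of 1 := by
      rw [phi_cons]
      change elem .α (phi (List.replicate (m + 1) .b) (of 1)) = _
      rw [(phi_replicate_b _).2]
      simp only [map_mul, map_pow, α0, α1, pow_succ]
    rw [e, isOcc_mul, isOcc_mul, isOcc_mul] at h2
    have h3 := h2.1.2.2
    rw [isOcc_of] at h3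
    simp only [length_pow_word, length_mul, length_of] at h3
    refine hcompl (2 * m + 1) ?_
    rw [hlong.2, ← h3]
    simp only [List.replicate_zero, act_nil, seed]
    congr 1
    ring
  · have hi1 : i = 1 := by
      rw [if_neg (by omega)] at hp
      omega
    subst hi1
    have hx3 : act (List.replicate 1 .b) (seed m v t) 3 = 0 := s3 1 (by omega)
    have v3 : v 3 = 1 := by
      have := hcompl 3
      rw [hx3] at this
      exact (by decide : ∀ c : Fin 2, 0 ≠ c → c = 1) _ this
    obtain rfl : m = 1 := by
      by_contra hm1
      obtain ⟨k, rfl⟩ : ∃ k, m = k + 2 := ⟨m - 2, by omega⟩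
      rw [pow_succ', pow_succ'] at hv
      simp only [mul_assoc, isOcc_mul, isOcc_of, length_of] at hv
      have := hv.2.2.2.1
      rw [v3] at this
      simp at this
    rcases (by omega : t = 1 ∨ t = 2) with rfl | rfl
    · -- `v` starts with `101101010` and `φ_b(v)` with `010010100`
      have h2 := isOcc_act h101 [.β, .b, .a]
      rw [show act [.β, .b, .a] v = v from hfix] at h2
      have e : phi [.β, .b, .a] (of 1 * of 0 * of 1) = of 1 * of 0 * of 1 * of 1 * of 0 * of 1 *
          of 0 * of 1 * of 0 * of 1 * of 1 * of 0 := rfl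
      rw [e] at h2
      have h8 : v 8 = 0 := by
        simp only [isOcc_mul, isOcc_of, length_mul, length_of] at h2
        exact h2.1.1.1.2
      have h6 : IsOcc v (of 1 * of 0 * of 1 * of 1 * of 0 * of 1) 0 := by
        simp only [isOcc_mul] at h2 ⊢
        exact h2.1.1.1.1.1.1
      have h3 := isOcc_act h6 [.b]
      have e3 : phi [.b] (of 1 * of 0 * of 1 * of 1 * of 0 * of 1) = of 0 * of 1 * of 0 * of 0 *
          of 1 * of 0 * of 1 * of 0 * of 0 * of 1 := rfl
      rw [e3] at h3
      simp only [isOcc_mul, isOcc_of, length_mul, length_of] at h3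
      exact hcompl 8 (h3.1.2.trans h8.symm)
    · have hx4 : act (List.replicate 1 .b) (seed 1 v 2) 4 = 0 := s3 2 (by omega)
      refine hcompl 4 ?_
      rw [hx4]
      simp only [isOcc_mul, isOcc_of, length_mul, length_of, length_pow_word] at hv
      exact hv.2.2.symm

/-- The derivated words are pairwise distinct up to a permutation of letters. -/
theorem letterClass_seed_injOn (hm : 1 ≤ m)
    (hfix : act (.β :: (List.replicate m .b ++ [.a])) v = v) {i t i' t' : ℕ} (ht : t ≤ 2)
    (ht' : t' ≤ 2) (hi : t = 0 → i < m) (hi' : t' = 0 → i' < m)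
    (h : letterClass (act (List.replicate i .b) (seed m v t)) =
      letterClass (act (List.replicate i' .b) (seed m v t'))) : i = i' ∧ t = t' := by
  have hv := isOcc_of_fixed hfix
  have hs := shape_seed hm hv i ht
  have hs' := shape_seed hm hv i' ht'
  have key : ∀ i t i' t' : ℕ, t ≤ 2 → t' ≤ 2 → (t' = 0 → i' < m) →
      (i + if t = 0 then 1 else 0) = 0 → (0 < i' + if t' = 0 then 1 else 0) →
      (∀ j, act (List.replicate i' .b) (seed m v t') j ≠
        act (List.replicate i .b) (seed m v t) j) → False := by
    intro i t i' t' ht ht' hi' hp hp' hc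
    obtain rfl : i = 0 := by omega
    have ht0 : t ≠ 0 := by rintro rfl; simp at hp
    rcases (by omega : t = 1 ∨ t = 2) with rfl | rfl
    · simp only [List.replicate_zero, act_nil, seed] at hc
      exact not_compl_fixed hm hfix ht' hc hp' hi'
    · have hx := (shape_iff _ _ _).1 (shape_seed hm hv 0 (t := 2) le_rfl)
      have hy := (shape_iff _ _ _).1 (shape_seed hm hv i' ht')
      simp only [OfNat.ofNat_ne_zero, if_false, Nat.add_zero, Nat.zero_add] at hx
      have x1 := hx.2.1 0 (by omega)
      have x2 := hx.2.1 1 (by omega)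
      have y1 : act (List.replicate i' .b) (seed m v t') 1 = 1 := by
        have := hc 1
        rw [x1] at this
        exact (by decide : ∀ c : Fin 2, c ≠ 0 → c = 1) _ this
      have hp1 : (i' + if t' = 0 then 1 else 0) = 1 := by
        by_contra hne
        rw [hy.1.1 1 (by omega)] at y1
        simp at y1
      rw [hp1] at hy
      have y2 := hy.2.1 0 (by omega)
      exact hc 2 (y2.trans x2.symm)
  rcases eq_or_compl_of_letterClass h with heq | hc
  · rw [← heq] at hs'
    obtain ⟨h1, h2⟩ := hs.unique hs'
    have : t = t' := by omega
    subst this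
    exact ⟨by omega, rfl⟩
  · exfalso
    rcases Nat.eq_zero_or_pos (i + if t = 0 then 1 else 0) with hp | hp <;>
      rcases Nat.eq_zero_or_pos (i' + if t' = 0 then 1 else 0) with hp' | hp'
    · have h1 := ((shape_iff _ _ _).1 hs).1.2
      have h2 := ((shape_iff _ _ _).1 hs').1.2
      rw [hp] at h1
      rw [hp'] at h2
      exact hc 0 (h2.trans h1.symm)
    · exact key i t i' t' ht ht' hi' hp hp' hc
    · exact key i' t' i t ht' ht hi hp' hp fun j => (hc j).symm
    · have h1 := ((shape_iff _ _ _).1 hs).1.1 0 hp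
      have h2 := ((shape_iff _ _ _).1 hs').1.1 0 hp'
      exact hc 0 (h2.trans h1.symm)

end Seeds

/-- The derivated words of the fixed point for `b^m α a`: `m` of them before the letter `α` of the
directive word, and twice `m + 1` after it. -/
theorem ncard_Der_nameMax {m : ℕ} (hm : 1 ≤ m) {u : InfWord} (hu : Full u)
    (hfix : act (nameMax m) u = u) : (Der u).ncard = 3 * m + 2 := by
  obtain ⟨w, h1, h2⟩ := exists_directive_nameMax hm hfix
  have hvfull := hu.act w
  set v := act w u with hv
  have hv0 : v 0 = 1 := by
    have := act_apply_zero (.β :: (List.replicate m .b ++ [.a])) v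
    rwa [h2] at this
  have hb : ∀ (p q : Fin 2) k, Admissible p q (List.replicate k .b) := fun p q k => by
    induction k with
    | zero => trivial
    | succ k ih => exact ih
  have had0 : Admissible (v 0) (v 0) (List.replicate m .b ++ .α :: List.replicate (m + 1) .b) := by
    rw [admissible_append]
    exact ⟨hb _ _ _, rfl, hb _ _ _⟩
  have had1 : Admissible (v 0) (v 0) (.β :: (List.replicate m .b ++ [.a])) := by
    change Admissible _ _ (List.replicate m .b ++ [.a])
    rw [admissible_append]
    exact ⟨hb _ _ _, hv0, trivial⟩
  have hder := Der_act hvfull had0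
  rw [h1, Der_eq_states hvfull had1 (List.countP_pos_iff.2 ⟨.β, by simp, rfl⟩) h2] at hder
  set f : ℕ × ℕ → Quotient permSetoid :=
    fun x => letterClass (act (List.replicate x.1 .b) (seed m v x.2)) with hf
  set J : Finset (ℕ × ℕ) := (Finset.range m ×ˢ {0}) ∪ (Finset.range (m + 1) ×ˢ {1, 2}) with hJ
  have hI : states (List.replicate m .b ++ .α :: List.replicate (m + 1) .b) v =
      (fun i => f (i, 0)) '' Set.Iio m ∪ (fun i => f (i, 1)) '' Set.Iio (m + 1) := by
    rw [states_append, states_replicate_b]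
    congr 1
    exact states_replicate_b (m + 1) v
  have hII : states (.β :: (List.replicate m .b ++ [.a])) v =
      (fun i => f (i, 2)) '' Set.Iio (m + 1) := by
    have := states_replicate_b (m + 1) (act [.a] v)
    refine Eq.trans ?_ this
    rw [List.replicate_succ, states, if_pos (by rfl), states, if_pos (by rfl), states_append,
      act_append, show states [.a] v = ∅ from rfl, Set.union_empty]
  have himage : Der u = f '' (J : Set (ℕ × ℕ)) := by
    rw [hder, hI, hII]
    ext q
    simp only [hJ, Set.mem_union, Set.mem_image, Set.mem_Iio, Finset.coe_union,
      Finset.mem_coe, Finset.mem_product, Finset.mem_range,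
      Finset.mem_singleton, Finset.mem_insert, Prod.exists]
    constructor
    · rintro ((⟨i, hi, rfl⟩ | ⟨i, hi, rfl⟩) | ⟨i, hi, rfl⟩)
      · exact ⟨i, 0, Or.inl ⟨hi, rfl⟩, rfl⟩
      · exact ⟨i, 1, Or.inr ⟨hi, Or.inl rfl⟩, rfl⟩
      · exact ⟨i, 2, Or.inr ⟨hi, Or.inr rfl⟩, rfl⟩
    · rintro ⟨i, t, ⟨hi, rfl⟩ | ⟨hi, rfl | rfl⟩, rfl⟩
      · exact Or.inl (Or.inl ⟨i, hi, rfl⟩)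
      · exact Or.inl (Or.inr ⟨i, hi, rfl⟩)
      · exact Or.inr ⟨i, hi, rfl⟩
  have hmem : ∀ x ∈ J, x.2 ≤ 2 ∧ (x.2 = 0 → x.1 < m) := fun x hx => by
    simp only [hJ, Finset.mem_union, Finset.mem_product, Finset.mem_range, Finset.mem_singleton,
      Finset.mem_insert] at hx
    omega
  have hinj : Set.InjOn f (J : Set (ℕ × ℕ)) := fun x hx y hy hxy => by
    obtain ⟨x1, x2⟩ := hmem x hx
    obtain ⟨y1, y2⟩ := hmem y hy
    obtain ⟨e1, e2⟩ := letterClass_seed_injOn hm h2 x1 y1 x2 y2 hxy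
    exact Prod.ext e1 e2
  rw [himage, hinj.ncard_image, Set.ncard_coe_finset, hJ, Finset.card_union_of_disjoint]
  · simp
    ring
  · rw [Finset.disjoint_left]
    intro x hx hx'
    simp only [Finset.mem_product, Finset.mem_singleton, Finset.mem_insert] at hx hx'
    omega

end SturmDer

open SturmDer

theorem corollary5p5 :
    (∀ (w : List Gen) (u : InfWord),
      ¬ InAAlpha w → IsNormalizedName (phi w) w → IsPrimitive (phi w) →
      IsFixedPoint (phi w) u →
      (Der u).Finite ∧ 1 ≤ (Der u).ncard ∧ ((Der u).ncard : ℤ) ≤ 3 * w.length - 4) ∧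
    (∀ n : ℕ, 2 ≤ n → ∃ w : List Gen,
      w.length = n ∧ ¬ InAAlpha w ∧ IsNormalizedName (phi w) w ∧ IsPrimitive (phi w) ∧
      NotPowerOfOther (phi w) ∧ (∃ u, IsFixedPoint (phi w) u) ∧
      ∀ u, IsFixedPoint (phi w) u → (Der u).ncard = 1) ∧
    (∀ n : ℕ, 3 ≤ n → ∃ w : List Gen,
      w.length = n ∧ ¬ InAAlpha w ∧ IsNormalizedName (phi w) w ∧ IsPrimitive (phi w) ∧
      NotPowerOfOther (phi w) ∧ (∃ u, IsFixedPoint (phi w) u) ∧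
      ∀ u, IsFixedPoint (phi w) u → ((Der u).ncard : ℤ) = 3 * n - 4) := by
  refine ⟨fun w u hw hn hp hu => ?_, fun n hn => ?_, fun n hn => ?_⟩
  · obtain ⟨h1, h2, h3, h4⟩ := derBound_of_isNormalizedName hw hn hp hu
    exact ⟨h2, (Set.ncard_pos h2).2 h3, by omega⟩
  · obtain ⟨m, rfl⟩ : ∃ m, n = m + 1 := ⟨n - 1, by omega⟩
    have hm : 1 ≤ m := by omega
    have hprim := isPrimitive_nameMin hm
    refine ⟨nameMin m, by simp [nameMin], fun h => ?_,
      isNormalizedName_of_isolated (fun v hv => (nameMin_isolated m _ _ hv).1 rfl)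
        (fun v hv => (nameMin_isolated m _ _ hv).2 rfl),
      hprim, notPowerOfOther_nameMin hm, exists_isFixedPoint_nameMin hm, fun u hu =>
        ncard_Der_nameMin (hu.full hprim) ((isFixedPoint_iff _ u).1 hu)⟩
    have := h .β (by simp [nameMin])
    simp at this
  · obtain ⟨m, rfl⟩ : ∃ m, n = m + 2 := ⟨n - 2, by omega⟩
    have hm : 1 ≤ m := by omega
    have hprim := isPrimitive_nameMax m
    refine ⟨nameMax m, by simp [nameMax], fun h => ?_,
      isNormalizedName_of_isolated (fun v hv => (nameMax_isolated m _ _ hv).1 rfl)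
        (fun v hv => (nameMax_isolated m _ _ hv).2 rfl),
      hprim, notPowerOfOther_nameMax hm, exists_isFixedPoint_nameMax m, fun u hu => ?_⟩
    · have := h .b (by simp [nameMax, List.mem_replicate]; omega)
      simp at this
    · rw [ncard_Der_nameMax hm (hu.full hprim) ((isFixedPoint_iff _ u).1 hu)]
      push_cast
      ring
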